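/- Let $(\Gamma,d)$ be a countable metric space. For $X\subset\Gamma$ and $r\ge 0$ put $X(r)=\{y\in\Gamma: d(y,x)\le r\text{ for some }x\in X\}$, and let $\mathcal P_0(\Gamma)$ be the set of finite subsets of $\Gamma$. To each $x\in\Gamma$ associate a finite-dimensional complex Hilbert space $\mathcal H_x$, and for $\Lambda\in\mathcal P_0(\Gamma)$ let $\mathcal A_\Lambda=\mathcal B\big(\bigotimes_{x\in\Lambda}\mathcal H_x\big)$ with the operator norm; for $\Lambda_0\subset\Lambda$, $\mathcal A_{\Lambda_0}$ is identified with $\mathcal A_{\Lambda_0}\otimes 1\subset\mathcal A_\Lambda$, and a linear map $\Phi$ on $\mathcal A_{\Lambda_0}$ acts on $\mathcal A_\Lambda$ as $\Phi\otimes\mathrm{id}$. Let $\|\Phi\|_{cb}=\sup_n\|\Phi\otimes\mathrm{id}_{M_n(\mathbb C)}\|$. Let $F:[0,\infty)\to(0,\infty)$ be an $F$-function on $(\Gamma,d)$: $F$ is non-increasing, $\sup_{x}\sum_{y}F(d(x,y))<\infty$, and for some $C>0$ $$\sum_{z\in\Gamma}F(d(x,z))F(d(z,y))\le C\,F(d(x,y))\qquad\text{for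 all }x,y\in\Gamma;$$ let $C_F$ be the infimum of all such $C$. Put $G(r)=\sup_{x\in\Gamma}\sum_{y:\,d(x,y)>r}F(d(x,y))$, and for $s\ge0$, $k>0$ put $\mathscr E_s(k)=\sum_{n\ge\lceil k\rceil}s^n/n!$. Let $\mathscr L=\{L_Z\}_{Z\in\mathcal P_0(\Gamma)}$ be a dissipative interaction: each $L_Z:\mathcal A_Z\to\mathcal A_Z$ has the Lindblad form $$L_Z(A)=i[H,A]+\sum_{j=1}^{\ell}\Big(K_j^*AK_j-\tfrac12\{K_j^*K_j,A\}\Big)$$ with $H=H^*$ and $K_1,\dots,K_\ell$ in $\mathcal A_Z$ (depending on $Z$). Let $\|\mathscr L\|_F$ be the infimum of all $M\ge0$ such that $\sum_{Z\ni x,y}\|L_Z\|_{cb}\le M\,F(d(x,y))$ for all $x,y\in\Gamma$, and assume $\|\mathscr L\|_F<\infty$. For $\Lambda\in\mathcal P_0(\Gamma)$, $t\ge0$ and $R>0$ let $$T^\Lambda_t=\exp\Big(t\sum_{Z\subset\Lambda}L_Z\Big),\qquad T^{\Lambda,R}_t=\exp\Big(t\sum_{Z\subset\Lambda,\ \mathrm{diam}(Z)\le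 R}L_Z\Big)$$ as maps on $\mathcal A_\Lambda$, and let $v=\|\mathscr L\|_F\,C_F$. Then for all finite $X\subset\Lambda\subset\Gamma$, all $A\in\mathcal A_X$ and all $t\ge0$, $r\ge0$, $R>0$, the set $X(r)$ is finite and $$\|T^\Lambda_t(A)-T^{\Lambda,R}_t(A)\|\le\|A\|\,\|\mathscr L\|_F\,G(R/2)\left(t\,|X(r)|+\frac{\mathscr E_{vt}(1+r/R)}{v\,C_F}\sum_{x\in X}\ \sum_{y\in\Lambda\setminus X(r)}F(d(x,y))\right),$$ where the right-hand side is read as $0$ if $\|\mathscr L\|_F=0$ or $\Gamma=\emptyset$. -/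

import Mathlib

open scoped ENNReal Matrix Nat Matrix.Norms.L2Operator

noncomputable section

namespace OpenSpin

/-! ### Finite volumes, observables

The spin at `x` has state space `ℂ^(ι x)`, with `ι x` an arbitrary finite type labelling an
orthonormal basis. The product configurations over `Λ` label an orthonormal basis of the tensor
product over `Λ`, and the observables are the operators on it, with their operator norm. -/

section Observables

variable {Γ : Type*} [DecidableEq Γ] (ι : Γ → Type*) [∀ x, Fintype (ι x)] [∀ x, DecidableEq (ι x)]

/-- Labels of the product orthonormal basis of the Hilbert space of the finite volume `Λ`. -/
abbrev Config (Λ : Finset Γ) : Type _ := ∀ x : Λ, ι x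

/-- The algebra of observables of the finite volume `Λ`: all operators on the tensor product of
the one-site spaces. Its norm is the operator norm for the Hilbert space norm. -/
abbrev Obs (Λ : Finset Γ) : Type _ := Matrix (Config ι Λ) (Config ι Λ) ℂ

variable {ι}

/-- Restriction of a configuration to a smaller volume. -/
def restrict {Z Λ : Finset Γ} (h : Z ⊆ Λ) (σ : Config ι Λ) : Config ι Z :=
  fun x => σ ⟨x, h x.2⟩

/-- The configuration equal to `a` on `Z` and to `σ` on `Λ \ Z`. -/
def glue {Z Λ : Finset Γ} (a : Config ι Z) (σ : Config ι Λ) : Config ι Λ :=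
  fun x => if hx : (x : Γ) ∈ Z then a ⟨x, hx⟩ else σ x

/-- The embedding `A ↦ A ⊗ 1` of the observables of `X` into those of `Λ ⊇ X`. -/
def embed {X Λ : Finset Γ} (h : X ⊆ Λ) (A : Obs ι X) : Obs ι Λ :=
  Matrix.of fun σ τ =>
    if ∀ x : Λ, (x : Γ) ∉ X → σ x = τ x then A (restrict h σ) (restrict h τ) else 0

/-- The extension `Φ ⊗ id` to the observables of `Λ ⊇ Z` of a linear map `Φ` on the observables
of `Z`: for fixed configurations off `Z`, the map `Φ` is applied to the block indexed by the
configurations on `Z`. -/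
def extend {Z Λ : Finset Γ} (h : Z ⊆ Λ) (Φ : Obs ι Z →ₗ[ℂ] Obs ι Z) :
    Obs ι Λ →ₗ[ℂ] Obs ι Λ where
  toFun M := Matrix.of fun σ τ =>
    Φ (Matrix.of fun a b => M (glue a σ) (glue b τ)) (restrict h σ) (restrict h τ)
  map_add' M N := by
    ext σ τ
    exact congrFun (congrFun (Φ.map_add (Matrix.of fun a b => M (glue a σ) (glue b τ))
      (Matrix.of fun a b => N (glue a σ) (glue b τ))) _) _
  map_smul' c M := by
    ext σ τ
    exact congrFun (congrFun (Φ.map_smul c (Matrix.of fun a b => M (glue a σ) (glue b τ))) _) _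

end Observables

/-! ### Completely bounded norm and Lindblad form -/

section Maps

variable {I : Type*} [Fintype I] [DecidableEq I]

/-- The map on `n × n` block matrices that applies `Φ` to every block. -/
def amplify (n : ℕ) (Φ : Matrix I I ℂ →ₗ[ℂ] Matrix I I ℂ) :
    Matrix (Fin n × I) (Fin n × I) ℂ →ₗ[ℂ] Matrix (Fin n × I) (Fin n × I) ℂ where
  toFun M := Matrix.of fun p q =>
    Φ (Matrix.of fun a b => M (p.1, a) (q.1, b)) p.2 q.2
  map_add' M N := by
    ext p q
    exact congrFun (congrFun (Φ.map_add (Matrix.of fun a b => M (p.1, a) (q.1, b))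
      (Matrix.of fun a b => N (p.1, a) (q.1, b))) _) _
  map_smul' c M := by
    ext p q
    exact congrFun (congrFun (Φ.map_smul c (Matrix.of fun a b => M (p.1, a) (q.1, b))) _) _

/-- The completely bounded norm: the supremum over `n` of the operator norms of the `n`-th
amplifications. -/
def cbNorm (Φ : Matrix I I ℂ →ₗ[ℂ] Matrix I I ℂ) : ℝ≥0∞ :=
  ⨆ n : ℕ, ENNReal.ofReal ‖LinearMap.toContinuousLinearMap (amplify n Φ)‖

/-- `Φ` is a Lindblad generator (in the Heisenberg picture). -/
def IsLindblad (Φ : Matrix I I ℂ →ₗ[ℂ] Matrix I I ℂ) : Prop :=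
  ∃ H : Matrix I I ℂ, H.IsHermitian ∧ ∃ (l : ℕ) (K : Fin l → Matrix I I ℂ),
    ∀ A : Matrix I I ℂ, Φ A = Complex.I • (H * A - A * H) +
      ∑ j, ((K j)ᴴ * A * K j - (1 / 2 : ℂ) • ((K j)ᴴ * K j * A + A * ((K j)ᴴ * K j)))

end Maps

/-! ### Decay functions -/

section Decay

variable (Γ : Type*) [MetricSpace Γ]

/-- `C` is admissible in the convolution condition for `F`. -/
def ConvBound (F : ℝ → ℝ) (C : ℝ) : Prop :=
  ∀ x y : Γ, ∑' z : Γ, ENNReal.ofReal (F (dist x z) * F (dist z y)) ≤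
    ENNReal.ofReal (C * F (dist x y))

/-- `F` (only its values on `[0, ∞)` matter) is an `F`-function on `Γ`. -/
structure IsFFunction (F : ℝ → ℝ) : Prop where
  pos : ∀ r, 0 ≤ r → 0 < F r
  antitone : AntitoneOn F (Set.Ici 0)
  summable : (⨆ x : Γ, ∑' y : Γ, ENNReal.ofReal (F (dist x y))) < ∞
  conv : ∃ C : ℝ, 0 < C ∧ ConvBound Γ F C

/-- The convolution constant `C_F`. -/
def convConst (F : ℝ → ℝ) : ℝ := sInf {C : ℝ | 0 < C ∧ ConvBound Γ F C}

/-- The tail function `G(r) = sup_x ∑_{d(x,y) > r} F(d(x,y))`; for an `F`-function the supremum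
is finite, so that no information is lost by `toReal`. -/
def tail (F : ℝ → ℝ) (r : ℝ) : ℝ :=
  (⨆ x : Γ, ∑' y : {y : Γ // r < dist x y}, ENNReal.ofReal (F (dist x y))).toReal

end Decay

/-- The tail `∑_{n ≥ ⌈k⌉} t^n / n!` of the exponential series. -/
def expTail (t k : ℝ) : ℝ := ∑' n : ℕ, t ^ (⌈k⌉₊ + n) / ((⌈k⌉₊ + n)! : ℝ)

/-! ### Interactions and dynamics -/

section Dynamics

variable {Γ : Type*} [MetricSpace Γ] [DecidableEq Γ]
  {ι : Γ → Type*} [∀ x, Fintype (ι x)] [∀ x, DecidableEq (ι x)]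

/-- The closed `r`-inflation `X(r)` of `X`, as a subset of the whole of `Γ`. -/
def inflation (X : Finset Γ) (r : ℝ) : Set Γ := {y | ∃ x ∈ X, dist y x ≤ r}

instance (X : Finset Γ) (r : ℝ) : DecidablePred (· ∈ inflation X r) :=
  Classical.decPred _

/-- The `F`-norm of a family of maps: the least `M` such that
`∑_{Z ∋ x, y} ‖L_Z‖_cb ≤ M F(d(x,y))` for all `x, y`. -/
def fNorm (F : ℝ → ℝ) (L : ∀ Z : Finset Γ, Obs ι Z →ₗ[ℂ] Obs ι Z) : ℝ≥0∞ :=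
  sInf {M : ℝ≥0∞ | ∀ x y : Γ,
    ∑' Z : {Z : Finset Γ // x ∈ Z ∧ y ∈ Z}, cbNorm (L Z) ≤ M * ENNReal.ofReal (F (dist x y))}

/-- The finite-volume generator `∑_{Z ⊆ Λ} L_Z`. -/
def generator (L : ∀ Z : Finset Γ, Obs ι Z →ₗ[ℂ] Obs ι Z) (Λ : Finset Γ) :
    Obs ι Λ →ₗ[ℂ] Obs ι Λ :=
  ∑ Z : {Z : Finset Γ // Z ∈ Λ.powerset}, extend (Finset.mem_powerset.1 Z.2) (L Z)

/-- The finite-range generator `∑_{Z ⊆ Λ, diam Z ≤ R} L_Z`. -/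
def generatorRange (L : ∀ Z : Finset Γ, Obs ι Z →ₗ[ℂ] Obs ι Z) (Λ : Finset Γ) (R : ℝ) :
    Obs ι Λ →ₗ[ℂ] Obs ι Λ :=
  ∑ Z : {Z : Finset Γ // Z ∈ Λ.powerset} with Metric.diam (Z.1 : Set Γ) ≤ R,
    extend (Finset.mem_powerset.1 Z.2) (L Z)

/-- The semigroup `exp (t 𝓖)` generated by a linear map `𝓖` on the observables of `Λ`. -/
def semigroup {Λ : Finset Γ} (𝓖 : Obs ι Λ →ₗ[ℂ] Obs ι Λ) (t : ℝ) : Obs ι Λ →L[ℂ] Obs ι Λ :=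
  NormedSpace.exp ((t : ℂ) • LinearMap.toContinuousLinearMap 𝓖)

/-- The finite-volume dynamics. -/
def dynamics (L : ∀ Z : Finset Γ, Obs ι Z →ₗ[ℂ] Obs ι Z) (Λ : Finset Γ) (t : ℝ) :
    Obs ι Λ →L[ℂ] Obs ι Λ :=
  semigroup (generator L Λ) t

/-- The finite-range approximation, of range `R`, of the finite-volume dynamics. -/
def dynamicsRange (L : ∀ Z : Finset Γ, Obs ι Z →ₗ[ℂ] Obs ι Z) (Λ : Finset Γ) (R t : ℝ) :
    Obs ι Λ →L[ℂ] Obs ι Λ :=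
  semigroup (generatorRange L Λ R) t

end Dynamics

end OpenSpin

end

set_option linter.unusedSectionVars false

namespace OpenSpin

/-! ### Dissipative operators and contraction semigroups -/

section Dissipative

open Filter Topology

variable {E : Type*} [NormedAddCommGroup E] [NormedSpace ℂ E]

/-- A bounded operator is dissipative if its logarithmic norm is nonpositive. -/
def IsDissipative (D : E →L[ℂ] E) : Prop :=
  ∀ δ : ℝ, 0 < δ → ∀ᶠ ε : ℝ in 𝓝[>] 0, ‖1 + (ε : ℂ) • D‖ ≤ 1 + δ * ε

theorem IsDissipative.zero : IsDissipative (0 : E →L[ℂ] E) := by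
  intro δ hδ
  filter_upwards [self_mem_nhdsWithin] with ε hε
  have hε : 0 < ε := hε
  have h1 : ‖(1 : E →L[ℂ] E)‖ ≤ 1 := ContinuousLinearMap.norm_id_le
  rw [smul_zero, add_zero]
  nlinarith [mul_pos hδ hε]

theorem IsDissipative.add {D D' : E →L[ℂ] E} (h : IsDissipative D) (h' : IsDissipative D') :
    IsDissipative (D + D') := by
  intro δ hδ
  have key : Tendsto (fun ε : ℝ => 2 * ε) (𝓝[>] 0) (𝓝[>] 0) := by
    refine tendsto_nhdsWithin_iff.2 ⟨?_, ?_⟩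
    · have : Tendsto (fun ε : ℝ => 2 * ε) (𝓝 0) (𝓝 (2 * 0)) :=
        (continuous_const.mul continuous_id).tendsto 0
      rw [mul_zero] at this
      exact this.mono_left nhdsWithin_le_nhds
    · filter_upwards [self_mem_nhdsWithin] with ε hε
      exact mul_pos two_pos (Set.mem_Ioi.1 hε)
  filter_upwards [key.eventually (h (δ / 2) (half_pos hδ)),
    key.eventually (h' (δ / 2) (half_pos hδ))] with ε h1 h2
  have e : (1 : E →L[ℂ] E) + (ε : ℂ) • (D + D') =
      (1 / 2 : ℂ) • (1 + ((2 * ε : ℝ) : ℂ) • D) + (1 / 2 : ℂ) • (1 + ((2 * ε : ℝ) : ℂ) • D') := by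
    push_cast
    module
  rw [e]
  refine (norm_add_le _ _).trans ?_
  rw [norm_smul, norm_smul]
  have e2 : ‖(1 / 2 : ℂ)‖ = 1 / 2 := by norm_num
  rw [e2]
  linarith

theorem IsDissipative.sum {α : Type*} {s : Finset α} {D : α → E →L[ℂ] E}
    (h : ∀ i ∈ s, IsDissipative (D i)) : IsDissipative (∑ i ∈ s, D i) :=
  Finset.sum_induction D IsDissipative (fun _ _ => IsDissipative.add) IsDissipative.zero h

theorem IsDissipative.of_quadratic_bound {D : E →L[ℂ] E} (c : ℝ)
    (h : ∀ ε : ℝ, 0 ≤ ε → ‖1 + (ε : ℂ) • D‖ ≤ 1 + c * ε ^ 2) : IsDissipative D := by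
  intro δ hδ
  have key : Tendsto (fun ε : ℝ => c * ε) (𝓝[>] 0) (𝓝 0) := by
    have : Tendsto (fun ε : ℝ => c * ε) (𝓝 0) (𝓝 (c * 0)) :=
      (continuous_const.mul continuous_id).tendsto 0
    rw [mul_zero] at this
    exact this.mono_left nhdsWithin_le_nhds
  filter_upwards [self_mem_nhdsWithin, key.eventually_lt_const hδ] with ε hε h1
  have hε : 0 < ε := hε
  refine (h ε hε.le).trans ?_
  nlinarith

variable [CompleteSpace E]

theorem hasDerivAt_exp_ofReal_smul (D : E →L[ℂ] E) (t : ℝ) :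
    HasDerivAt (fun u : ℝ => NormedSpace.exp ((u : ℂ) • D))
      (D * NormedSpace.exp ((t : ℂ) • D)) t := by
  have h := (hasDerivAt_exp_smul_const' D (t : ℂ)).scomp t Complex.ofRealCLM.hasDerivAt
  rw [Complex.ofRealCLM_apply, Complex.ofReal_one, one_smul] at h
  exact h

theorem IsDissipative.norm_exp_le {D : E →L[ℂ] E} (h : IsDissipative D) {t : ℝ} (ht : 0 ≤ t) :
    ‖NormedSpace.exp ((t : ℂ) • D)‖ ≤ 1 := by
  rcases ht.eq_or_lt with rfl | ht
  · rw [Complex.ofReal_zero, zero_smul, NormedSpace.exp_zero]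
    exact ContinuousLinearMap.norm_id_le
  have main : ∀ δ : ℝ, 0 < δ → ‖NormedSpace.exp ((t : ℂ) • D)‖ ≤ Real.exp (2 * δ * t) := by
    intro δ hδ
    have hd := (hasDerivAt_exp_ofReal_smul D 0).isLittleO.def hδ
    have hd' : ∀ᶠ ε : ℝ in 𝓝[>] 0, ‖NormedSpace.exp ((ε : ℂ) • D)‖ ≤ 1 + 2 * δ * ε := by
      filter_upwards [h δ hδ, hd.filter_mono nhdsWithin_le_nhds, self_mem_nhdsWithin] with ε h1 h2 h3
      have h3 : 0 < ε := h3
      simp only [sub_zero, Complex.ofReal_zero, zero_smul, NormedSpace.exp_zero, mul_one,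
        Real.norm_eq_abs, abs_of_pos h3] at h2
      have e : NormedSpace.exp ((ε : ℂ) • D) = (1 + (ε : ℂ) • D) +
          (NormedSpace.exp ((ε : ℂ) • D) - 1 - ε • D) := by
        rw [← Complex.coe_smul]
        abel
      rw [e]
      refine (norm_add_le _ _).trans ?_
      linarith
    have hn : Tendsto (fun n : ℕ => t / n) atTop (𝓝[>] 0) := by
      refine tendsto_nhdsWithin_iff.2 ⟨tendsto_const_div_atTop_nhds_zero_nat t, ?_⟩
      filter_upwards [eventually_gt_atTop 0] with n hn
      exact div_pos ht (Nat.cast_pos.2 hn)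
    obtain ⟨n, h1, hn0⟩ := ((hn.eventually hd').and (eventually_gt_atTop 0)).exists
    have hn0' : (n : ℝ) ≠ 0 := Nat.cast_ne_zero.2 hn0.ne'
    have e : (t : ℂ) • D = n • (((t / n : ℝ) : ℂ) • D) := by
      rw [← Nat.cast_smul_eq_nsmul ℂ, smul_smul]
      congr 1
      rw [← Complex.ofReal_natCast, ← Complex.ofReal_mul, mul_div_cancel₀ t hn0']
    let _ : NormedAlgebra ℚ (E →L[ℂ] E) := NormedAlgebra.restrictScalars ℚ ℂ _
    rw [e, NormedSpace.exp_nsmul]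
    calc _ ≤ ‖NormedSpace.exp (((t / n : ℝ) : ℂ) • D)‖ ^ n := norm_pow_le' _ hn0
      _ ≤ (1 + 2 * δ * (t / n)) ^ n := by gcongr
      _ ≤ (Real.exp (2 * δ * (t / n))) ^ n := by
        gcongr
        rw [add_comm]
        exact Real.add_one_le_exp _
      _ = _ := by
        rw [← Real.exp_nat_mul]
        congr 1
        field_simp
  have lim : Tendsto (fun δ : ℝ => Real.exp (2 * δ * t)) (𝓝[>] 0) (𝓝 1) := by
    have : Tendsto (fun δ : ℝ => Real.exp (2 * δ * t)) (𝓝 0) (𝓝 (Real.exp (2 * 0 * t))) :=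
      Continuous.tendsto (by fun_prop) 0
    simp only [mul_zero, zero_mul, Real.exp_zero] at this
    exact this.mono_left nhdsWithin_le_nhds
  exact ge_of_tendsto lim (by filter_upwards [self_mem_nhdsWithin] with δ hδ using main δ hδ)

/-- An inhomogeneous linear evolution equation with a dissipative operator: the norm of the
solution is bounded by any primitive of a bound on the inhomogeneity. -/
theorem IsDissipative.norm_le_of_hasDerivAt {D : E →L[ℂ] E} (h : IsDissipative D)
    {f g : ℝ → E} (hf : ∀ s, HasDerivAt f (D (f s) + g s) s) {B B' : ℝ → ℝ}
    (hB : ∀ s, HasDerivAt B (B' s) s) (h0 : ‖f 0‖ ≤ B 0) {t : ℝ} (ht : 0 ≤ t)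
    (hg : ∀ s, 0 ≤ s → s ≤ t → ‖g s‖ ≤ B' s) : ‖f t‖ ≤ B t := by
  have hd : ∀ s, HasDerivAt (fun s : ℝ => NormedSpace.exp (((t - s : ℝ) : ℂ) • D) (f s))
      (NormedSpace.exp (((t - s : ℝ) : ℂ) • D) (g s)) s := by
    intro s
    have h1 : HasDerivAt (fun s : ℝ => NormedSpace.exp (((t - s : ℝ) : ℂ) • D))
        ((-1 : ℂ) • (NormedSpace.exp (((t - s : ℝ) : ℂ) • D) * D)) s := by
      have h3 : HasDerivAt (fun s : ℝ => ((t - s : ℝ) : ℂ)) (-1 : ℂ) s := by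
        simpa using ((hasDerivAt_id s).const_sub t).ofReal_comp
      exact (hasDerivAt_exp_smul_const D ((t - s : ℝ) : ℂ)).scomp s h3
    have h2 := ((ContinuousLinearMap.restrictScalarsL ℂ E E ℝ ℝ).hasFDerivAt.comp_hasDerivAt s
      h1).clm_apply (hf s)
    refine h2.congr_deriv ?_
    simp
  have key := image_norm_le_of_norm_deriv_right_le_deriv_boundary (a := 0) (b := t)
    (fun s _ => (hd s).continuousAt.continuousWithinAt)
    (fun s _ => (hd s).hasDerivWithinAt) (B := B) (B' := B') ?_ hB ?_ (Set.right_mem_Icc.2 ht)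
  · simpa using key
  · refine le_trans ?_ h0
    refine (ContinuousLinearMap.le_opNorm _ _).trans ?_
    exact mul_le_of_le_one_left (norm_nonneg _) (h.norm_exp_le (by simpa using ht))
  · intro s hs
    refine le_trans ?_ (hg s hs.1 hs.2.le)
    refine (ContinuousLinearMap.le_opNorm _ _).trans ?_
    exact mul_le_of_le_one_left (norm_nonneg _) (h.norm_exp_le (sub_nonneg.2 hs.2.le))

end Dissipative

/-! ### Lindblad generators on matrix algebras -/

section Maps

open scoped Kronecker

variable {I : Type*}

/-- The block with block indices `i`, `j`. -/
def block {n : ℕ} (M : Matrix (Fin n × I) (Fin n × I) ℂ) (i j : Fin n) : Matrix I I ℂ :=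
  Matrix.of fun a b => M (i, a) (j, b)

theorem block_kronecker_mul {n : ℕ} [Fintype I] (B : Matrix I I ℂ) (M : Matrix (Fin n × I) (Fin n × I) ℂ)
    (i j : Fin n) : block (((1 : Matrix (Fin n) (Fin n) ℂ) ⊗ₖ B) * M) i j = B * block M i j := by
  ext a b
  simp only [block, Matrix.of_apply, Matrix.mul_apply, Fintype.sum_prod_type,
    Matrix.kroneckerMap_apply, Matrix.one_apply, ite_mul, one_mul, zero_mul, Finset.sum_ite_irrel,
    Finset.sum_const_zero]
  simp

theorem block_mul_kronecker {n : ℕ} [Fintype I] (B : Matrix I I ℂ) (M : Matrix (Fin n × I) (Fin n × I) ℂ)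
    (i j : Fin n) : block (M * ((1 : Matrix (Fin n) (Fin n) ℂ) ⊗ₖ B)) i j = block M i j * B := by
  ext a b
  simp only [block, Matrix.of_apply, Matrix.mul_apply, Fintype.sum_prod_type,
    Matrix.kroneckerMap_apply, Matrix.one_apply, ite_mul, one_mul, zero_mul, mul_ite, mul_zero,
    Finset.sum_ite_irrel, Finset.sum_const_zero]
  simp

variable {J : Type*} [Fintype I] [DecidableEq I] [Fintype J] [DecidableEq J]

theorem norm_one_kronecker_le (A : Matrix I I ℂ) : ‖(1 : Matrix J J ℂ) ⊗ₖ A‖ ≤ ‖A‖ := by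
  let f : Matrix I I ℂ →⋆ₙₐ[ℂ] Matrix (J × I) (J × I) ℂ :=
    { toFun := fun A => (1 : Matrix J J ℂ) ⊗ₖ A
      map_smul' := fun c A => Matrix.kronecker_smul c _ A
      map_zero' := Matrix.kronecker_zero _
      map_add' := fun A B => Matrix.kronecker_add _ A B
      map_mul' := fun A B => by rw [← Matrix.mul_kronecker_mul, one_mul]
      map_star' := fun A => by
        simp only [Matrix.star_eq_conjTranspose, Matrix.conjTranspose_kronecker,
          Matrix.conjTranspose_one] }
  exact NonUnitalStarAlgHom.norm_apply_le f A

theorem norm_submatrix_equiv_le (e : J ≃ I) (A : Matrix I I ℂ) : ‖A.submatrix e e‖ ≤ ‖A‖ := by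
  let f : Matrix I I ℂ →⋆ₙₐ[ℂ] Matrix J J ℂ :=
    { toFun := fun A => A.submatrix e e
      map_smul' := fun c A => rfl
      map_zero' := rfl
      map_add' := fun A B => rfl
      map_mul' := fun A B => (Matrix.submatrix_mul_equiv A B e e e).symm
      map_star' := fun A => rfl }
  exact NonUnitalStarAlgHom.norm_apply_le f A

/-- The norm of a completely positive map in Kraus form is attained at the identity. -/
theorem norm_kraus_le (W : J → Matrix I I ℂ) (A : Matrix I I ℂ) :
    ‖∑ j, (W j)ᴴ * A * W j‖ ≤ ‖∑ j, (W j)ᴴ * W j‖ * ‖A‖ := by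
  let V : Matrix (J × I) I ℂ := Matrix.of fun p b => W p.1 p.2 b
  have h1 : ∑ j, (W j)ᴴ * A * W j = Vᴴ * ((1 : Matrix J J ℂ) ⊗ₖ A) * V := by
    ext a b
    simp only [Matrix.sum_apply, Matrix.mul_apply, Fintype.sum_prod_type, V,
      Matrix.conjTranspose_apply, Matrix.of_apply, Matrix.kroneckerMap_apply, Matrix.one_apply,
      ite_mul, one_mul, zero_mul, mul_ite, mul_zero, Finset.sum_ite_irrel, Finset.sum_const_zero]
    simp
  have h2 : ∑ j, (W j)ᴴ * W j = Vᴴ * V := by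
    ext a b
    simp [Matrix.sum_apply, Matrix.mul_apply, Fintype.sum_prod_type, V]
  rw [h1, h2, Matrix.l2_opNorm_conjTranspose_mul_self]
  calc _ ≤ ‖Vᴴ * ((1 : Matrix J J ℂ) ⊗ₖ A)‖ * ‖V‖ := Matrix.l2_opNorm_mul _ _
    _ ≤ (‖Vᴴ‖ * ‖(1 : Matrix J J ℂ) ⊗ₖ A‖) * ‖V‖ := by
      gcongr
      exact Matrix.l2_opNorm_mul _ _
    _ ≤ (‖V‖ * ‖A‖) * ‖V‖ := by
      rw [Matrix.l2_opNorm_conjTranspose]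
      gcongr
      exact norm_one_kronecker_le A
    _ = _ := by ring

theorem norm_matrix_one_le : ‖(1 : Matrix I I ℂ)‖ ≤ 1 := by
  have h := CStarRing.norm_star_mul_self (x := (1 : Matrix I I ℂ))
  rw [star_one, one_mul] at h
  nlinarith [norm_nonneg (1 : Matrix I I ℂ), sq_nonneg (‖(1 : Matrix I I ℂ)‖ - 1)]

theorem IsLindblad.map_one {Φ : Matrix I I ℂ →ₗ[ℂ] Matrix I I ℂ} (h : IsLindblad Φ) :
    Φ 1 = 0 := by
  obtain ⟨H, -, l, K, hK⟩ := h
  rw [hK]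
  simp only [mul_one, one_mul, sub_self, smul_zero, zero_add]
  refine Finset.sum_eq_zero fun j _ => ?_
  module

theorem IsLindblad.norm_add_smul_le {Φ : Matrix I I ℂ →ₗ[ℂ] Matrix I I ℂ} (h : IsLindblad Φ) :
    ∃ c : ℝ, ∀ ε : ℝ, 0 ≤ ε → ∀ A, ‖A + (ε : ℂ) • Φ A‖ ≤ (1 + c * ε ^ 2) * ‖A‖ := by
  obtain ⟨H, hH, l, K, hK⟩ := h
  set S : Matrix I I ℂ := ∑ j, (K j)ᴴ * K j with hS
  set G : Matrix I I ℂ := -Complex.I • H - (1 / 2 : ℂ) • S with hG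
  have hSH : Sᴴ = S := by
    simp [hS, Matrix.conjTranspose_sum]
  have hGH : Gᴴ = Complex.I • H - (1 / 2 : ℂ) • S := by
    rw [hG, Matrix.conjTranspose_sub, Matrix.conjTranspose_smul, Matrix.conjTranspose_smul, hSH,
      hH.eq]
    simp
  have hΦ : ∀ A, Φ A = Gᴴ * A + A * G + ∑ j, (K j)ᴴ * A * K j := by
    intro A
    rw [hK, Finset.sum_sub_distrib, ← Finset.smul_sum, Finset.sum_add_distrib, ← Finset.sum_mul,
      ← Finset.mul_sum, ← hS, hGH, hG]
    simp only [sub_mul, mul_sub, smul_mul_assoc, mul_smul_comm]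
    module
  have hG1 : Gᴴ + G + S = 0 := by
    rw [hGH, hG]
    module
  refine ⟨2 * ‖G‖ ^ 2, fun ε hε A => ?_⟩
  let W : Option (Fin l) → Matrix I I ℂ := fun o => o.elim (1 + (ε : ℂ) • G)
    fun j => ((Real.sqrt ε : ℝ) : ℂ) • K j
  have hsq : ((Real.sqrt ε : ℝ) : ℂ) * ((Real.sqrt ε : ℝ) : ℂ) = (ε : ℂ) := by
    rw [← Complex.ofReal_mul, Real.mul_self_sqrt hε]
  have hW : ∀ B, ∑ o, (W o)ᴴ * B * W o = B + (ε : ℂ) • Φ B + ((ε : ℂ) ^ 2) • (Gᴴ * B * G) := by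
    intro B
    have hj : ∀ j, (W (some j))ᴴ * B * W (some j) = (ε : ℂ) • ((K j)ᴴ * B * K j) := by
      intro j
      simp only [W, Option.elim, Matrix.conjTranspose_smul, Complex.star_def, Complex.conj_ofReal,
        smul_mul_assoc, mul_smul_comm, smul_smul, hsq]
    rw [Fintype.sum_option, Finset.sum_congr rfl fun j _ => hj j, ← Finset.smul_sum, hΦ]
    simp only [W, Option.elim, Matrix.conjTranspose_add, Matrix.conjTranspose_one,
      Matrix.conjTranspose_smul, Complex.star_def, Complex.conj_ofReal, add_mul, mul_add, one_mul,
      mul_one, smul_mul_assoc, mul_smul_comm]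
    module
  have hW1 : ∑ o, (W o)ᴴ * W o = 1 + ((ε : ℂ) ^ 2) • (Gᴴ * G) := by
    have h1 := hW 1
    simp only [mul_one] at h1
    have h2 : Φ 1 = 0 := by
      rw [hΦ, mul_one, one_mul, ← hG1, hS]
      simp
    rw [h1, h2, smul_zero, add_zero]
  have hsm : ∀ B : Matrix I I ℂ, ‖((ε : ℂ) ^ 2) • B‖ = ε ^ 2 * ‖B‖ := by
    intro B
    rw [norm_smul, norm_pow, Complex.norm_real, Real.norm_eq_abs, sq_abs]
  have hGn : ‖Gᴴ‖ = ‖G‖ := Matrix.l2_opNorm_conjTranspose G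
  have e : A + (ε : ℂ) • Φ A = ∑ o, (W o)ᴴ * A * W o - ((ε : ℂ) ^ 2) • (Gᴴ * A * G) := by
    rw [hW]
    abel
  rw [e]
  have b1 : ‖∑ o, (W o)ᴴ * A * W o‖ ≤ (1 + ε ^ 2 * ‖G‖ ^ 2) * ‖A‖ := by
    refine (norm_kraus_le W A).trans ?_
    gcongr
    rw [hW1]
    refine (norm_add_le _ _).trans (add_le_add norm_matrix_one_le ?_)
    rw [hsm]
    gcongr
    refine (norm_mul_le _ _).trans ?_
    rw [hGn, sq]
  have b2 : ‖((ε : ℂ) ^ 2) • (Gᴴ * A * G)‖ ≤ ε ^ 2 * (‖G‖ ^ 2 * ‖A‖) := by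
    rw [hsm]
    gcongr
    refine (norm_mul_le _ _).trans ?_
    have := norm_mul_le Gᴴ A
    rw [hGn] at this
    nlinarith [norm_nonneg G]
  refine (norm_sub_le _ _).trans ?_
  nlinarith

theorem IsLindblad.amplify {Φ : Matrix I I ℂ →ₗ[ℂ] Matrix I I ℂ} (h : IsLindblad Φ) (n : ℕ) :
    IsLindblad (amplify n Φ) := by
  obtain ⟨H, hH, l, K, hK⟩ := h
  refine ⟨(1 : Matrix (Fin n) (Fin n) ℂ) ⊗ₖ H, ?_, l,
    fun j => (1 : Matrix (Fin n) (Fin n) ℂ) ⊗ₖ K j, fun M => ?_⟩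
  · rw [Matrix.IsHermitian, Matrix.conjTranspose_kronecker, Matrix.conjTranspose_one, hH.eq]
  · have hb : ∀ i j, block (OpenSpin.amplify n Φ M) i j = Φ (block M i j) := fun i j => rfl
    have ext_block : ∀ N N' : Matrix (Fin n × I) (Fin n × I) ℂ,
        (∀ i j, block N i j = block N' i j) → N = N' := by
      intro N N' hN
      ext p q
      exact congrFun (congrFun (hN p.1 q.1) p.2) q.2
    have bsub : ∀ (N N' : Matrix (Fin n × I) (Fin n × I) ℂ) i j,
        block (N - N') i j = block N i j - block N' i j := fun _ _ _ _ => rfl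
    have badd : ∀ (N N' : Matrix (Fin n × I) (Fin n × I) ℂ) i j,
        block (N + N') i j = block N i j + block N' i j := fun _ _ _ _ => rfl
    have bsmul : ∀ (c : ℂ) (N : Matrix (Fin n × I) (Fin n × I) ℂ) i j,
        block (c • N) i j = c • block N i j := fun _ _ _ _ => rfl
    have bsum : ∀ (N : Fin l → Matrix (Fin n × I) (Fin n × I) ℂ) i j,
        block (∑ k, N k) i j = ∑ k, block (N k) i j := by
      intro N i j
      ext a b
      simp [block, Matrix.sum_apply]
    refine ext_block _ _ fun i j => ?_
    rw [hb, hK]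
    simp only [badd, bsmul, bsub, bsum, Matrix.conjTranspose_kronecker, Matrix.conjTranspose_one,
      block_mul_kronecker, block_kronecker_mul, ← Matrix.mul_kronecker_mul, one_mul]

end Maps

/-! ### Local maps in a larger volume -/

section Extend

open scoped Kronecker

variable {Γ : Type*} [DecidableEq Γ] {ι : Γ → Type*} {X Y Z Λ : Finset Γ}

/-- A configuration over `Λ` amounts to one over `Λ \ Z` and one over `Z`. -/
def splitEquiv (h : Z ⊆ Λ) : Config ι Λ ≃ Config ι (Λ \ Z) × Config ι Z where
  toFun σ := (restrict Finset.sdiff_subset σ, restrict h σ)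
  invFun p := fun x => if hx : (x : Γ) ∈ Z then p.2 ⟨x, hx⟩
    else p.1 ⟨x, Finset.mem_sdiff.2 ⟨x.2, hx⟩⟩
  left_inv σ := by
    funext x
    by_cases hx : (x : Γ) ∈ Z <;> simp [restrict, hx]
  right_inv p := by
    refine Prod.ext ?_ ?_
    · funext x
      have hx : (x : Γ) ∉ Z := (Finset.mem_sdiff.1 x.2).2
      simp [restrict, hx]
    · funext x
      have hx : (x : Γ) ∈ Z := x.2
      simp [restrict, hx]

theorem splitEquiv_symm_apply (h : Z ⊆ Λ) (a : Config ι Z) (σ : Config ι Λ) :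
    (splitEquiv h).symm ((splitEquiv h σ).1, a) = glue a σ := by
  funext x
  by_cases hx : (x : Γ) ∈ Z <;> simp [splitEquiv, glue, restrict, hx]

theorem restrict_glue_of_disjoint (hY : Y ⊆ Λ) (hd : Disjoint Y Z) (a : Config ι Z)
    (σ : Config ι Λ) : restrict hY (glue a σ) = restrict hY σ := by
  funext x
  have hx : (x : Γ) ∉ Z := fun hz => Finset.disjoint_left.1 hd x.2 hz
  simp [restrict, glue, hx]

theorem glue_comm (hd : Disjoint Y Z) (a : Config ι Z) (b : Config ι Y) (σ : Config ι Λ) :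
    glue a (glue b σ) = glue b (glue a σ) := by
  funext x
  by_cases hx : (x : Γ) ∈ Z
  · have hy : (x : Γ) ∉ Y := fun hy => Finset.disjoint_left.1 hd hy hx
    simp [glue, hx, hy]
  · simp [glue, hx]

variable [∀ x, Fintype (ι x)] [∀ x, DecidableEq (ι x)]

/-- The splitting of configurations with the outer configurations numbered. -/
noncomputable def splitFin (ι : Γ → Type*) [∀ x, Fintype (ι x)] [∀ x, DecidableEq (ι x)]
    (h : Z ⊆ Λ) : Config ι Λ ≃ Fin (Fintype.card (Config ι (Λ \ Z))) × Config ι Z :=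
  (splitEquiv h).trans ((Fintype.equivFin _).prodCongr (Equiv.refl _))

theorem splitFin_apply_snd (h : Z ⊆ Λ) (σ : Config ι Λ) : (splitFin ι h σ).2 = restrict h σ := rfl

theorem splitFin_symm_apply (h : Z ⊆ Λ) (a : Config ι Z) (σ : Config ι Λ) :
    (splitFin ι h).symm ((splitFin ι h σ).1, a) = glue a σ := by
  rw [← splitEquiv_symm_apply h a σ]
  simp [splitFin]

theorem extend_eq_amplify (h : Z ⊆ Λ) (Φ : Obs ι Z →ₗ[ℂ] Obs ι Z) (M : Obs ι Λ) :
    extend h Φ M = (amplify _ Φ (M.submatrix (splitFin ι h).symm (splitFin ι h).symm)).submatrix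
      (splitFin ι h) (splitFin ι h) := by
  ext σ τ
  simp only [extend, amplify, LinearMap.coe_mk, AddHom.coe_mk, Matrix.of_apply,
    Matrix.submatrix_apply, splitFin_symm_apply, splitFin_apply_snd]

theorem embed_eq_kronecker (h : Z ⊆ Λ) (A : Obs ι Z) :
    embed h A = ((1 : Matrix (Fin _) (Fin _) ℂ) ⊗ₖ A).submatrix (splitFin ι h) (splitFin ι h) := by
  ext σ τ
  have key : (∀ x : Λ, (x : Γ) ∉ Z → σ x = τ x) ↔ (splitFin ι h σ).1 = (splitFin ι h τ).1 := by
    simp only [splitFin, Equiv.trans_apply, Equiv.prodCongr_apply, Prod.map_fst,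
      EmbeddingLike.apply_eq_iff_eq]
    constructor
    · intro H
      funext x
      exact H ⟨x, Finset.sdiff_subset x.2⟩ (Finset.mem_sdiff.1 x.2).2
    · intro H x hx
      exact congrFun H ⟨x, Finset.mem_sdiff.2 ⟨x.2, hx⟩⟩
  simp only [embed, Matrix.of_apply, Matrix.submatrix_apply, Matrix.kroneckerMap_apply,
    Matrix.one_apply, splitFin_apply_snd, key, ite_mul, one_mul, zero_mul]

theorem norm_embed_le (h : Z ⊆ Λ) (A : Obs ι Z) : ‖embed h A‖ ≤ ‖A‖ := by
  rw [embed_eq_kronecker]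
  exact (norm_submatrix_equiv_le _ _).trans (norm_one_kronecker_le A)

theorem norm_extend_le (h : Z ⊆ Λ) {Φ : Obs ι Z →ₗ[ℂ] Obs ι Z} (hΦ : cbNorm Φ ≠ ∞)
    (M : Obs ι Λ) : ‖extend h Φ M‖ ≤ (cbNorm Φ).toReal * ‖M‖ := by
  rw [extend_eq_amplify]
  refine (norm_submatrix_equiv_le _ _).trans ?_
  refine ((LinearMap.toContinuousLinearMap (amplify _ Φ)).le_opNorm _).trans ?_
  gcongr
  · refine (ENNReal.ofReal_le_iff_le_toReal hΦ).1 ?_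
    exact le_iSup (fun n : ℕ => ENNReal.ofReal ‖LinearMap.toContinuousLinearMap (amplify n Φ)‖) _
  · exact norm_submatrix_equiv_le _ _

theorem IsLindblad.isDissipative_extend (h : Z ⊆ Λ) {Φ : Obs ι Z →ₗ[ℂ] Obs ι Z}
    (hΦ : IsLindblad Φ) : IsDissipative (LinearMap.toContinuousLinearMap (extend h Φ)) := by
  obtain ⟨c, hc⟩ := (hΦ.amplify (Fintype.card (Config ι (Λ \ Z)))).norm_add_smul_le
  refine IsDissipative.of_quadratic_bound (max c 0) fun ε hε => ?_
  refine ContinuousLinearMap.opNorm_le_bound _ (by positivity) fun M => ?_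
  have e : (1 + (ε : ℂ) • LinearMap.toContinuousLinearMap (extend h Φ)) M =
      (M.submatrix (splitFin ι h).symm (splitFin ι h).symm + (ε : ℂ) •
        OpenSpin.amplify _ Φ (M.submatrix (splitFin ι h).symm (splitFin ι h).symm)).submatrix
      (splitFin ι h) (splitFin ι h) := by
    change M + (ε : ℂ) • extend h Φ M = _
    rw [extend_eq_amplify, Matrix.submatrix_add, Matrix.submatrix_smul]
    simp
  rw [e]
  refine (norm_submatrix_equiv_le _ _).trans ((hc ε hε _).trans ?_)
  have h1 : ‖M.submatrix (splitFin ι h).symm (splitFin ι h).symm‖ ≤ ‖M‖ :=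
    norm_submatrix_equiv_le _ _
  have h2 : c ≤ max c 0 := le_max_left _ _
  gcongr

theorem extend_embed_eq_zero (hZ : Z ⊆ Λ) (hX : X ⊆ Λ) (hd : Disjoint X Z)
    {Φ : Obs ι Z →ₗ[ℂ] Obs ι Z} (hΦ : Φ 1 = 0) (A : Obs ι X) :
    extend hZ Φ (embed hX A) = 0 := by
  ext σ τ
  have key : (Matrix.of fun a b => embed hX A (glue a σ) (glue b τ) : Obs ι Z) =
      (if ∀ x : Λ, (x : Γ) ∉ X → (x : Γ) ∉ Z → σ x = τ x then
        A (restrict hX σ) (restrict hX τ) else 0) • (1 : Obs ι Z) := by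
    ext a b
    simp only [embed, Matrix.of_apply, Matrix.smul_apply, restrict_glue_of_disjoint hX hd,
      Matrix.one_apply, smul_eq_mul, mul_ite, mul_one, mul_zero]
    have iff1 : (∀ x : Λ, (x : Γ) ∉ X → glue a σ x = glue b τ x) ↔
        a = b ∧ ∀ x : Λ, (x : Γ) ∉ X → (x : Γ) ∉ Z → σ x = τ x := by
      constructor
      · intro H
        refine ⟨?_, fun x hx hz => ?_⟩
        · funext x
          have h1 := H ⟨x, hZ x.2⟩ fun hx => Finset.disjoint_left.1 hd hx x.2
          simpa [glue] using h1
        · simpa [glue, hz] using H x hx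
      · rintro ⟨rfl, H⟩ x hx
        by_cases hz : (x : Γ) ∈ Z
        · simp [glue, hz]
        · simpa [glue, hz] using H x hx hz
    simp only [iff1, ite_and]
  change Φ (Matrix.of fun a b => embed hX A (glue a σ) (glue b τ)) _ _ = 0
  rw [key, map_smul, hΦ, smul_zero]
  rfl

/-- Expansion of a linear map on matrices along the matrix units. -/
theorem linearMap_apply_eq_sum {I : Type*} [Fintype I] [DecidableEq I]
    (Φ : Matrix I I ℂ →ₗ[ℂ] Matrix I I ℂ) (M : Matrix I I ℂ) (i j : I) :
    Φ M i j = ∑ a, ∑ b, M a b * Φ (Matrix.single a b 1) i j := by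
  conv_lhs => rw [Matrix.matrix_eq_sum_single M]
  simp only [map_sum, Matrix.sum_apply]
  refine Finset.sum_congr rfl fun a _ => Finset.sum_congr rfl fun b _ => ?_
  have : Matrix.single a b (M a b) = M a b • Matrix.single a b (1 : ℂ) := by simp
  rw [this, map_smul]
  rfl

theorem extend_comm (hY : Y ⊆ Λ) (hZ : Z ⊆ Λ) (hd : Disjoint Y Z)
    (Φ : Obs ι Y →ₗ[ℂ] Obs ι Y) (Ψ : Obs ι Z →ₗ[ℂ] Obs ι Z) (M : Obs ι Λ) :
    extend hY Φ (extend hZ Ψ M) = extend hZ Ψ (extend hY Φ M) := by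
  ext σ τ
  have hl : ∀ {W : Finset Γ} (hW : W ⊆ Λ) (Θ : Obs ι W →ₗ[ℂ] Obs ι W) (N : Obs ι Λ)
      (σ τ : Config ι Λ), extend hW Θ N σ τ = ∑ a, ∑ b, N (glue a σ) (glue b τ) *
        Θ (Matrix.single a b 1) (restrict hW σ) (restrict hW τ) := by
    intro W hW Θ N σ τ
    change Θ _ _ _ = _
    rw [linearMap_apply_eq_sum]
    rfl
  simp only [hl, restrict_glue_of_disjoint hZ hd.symm, restrict_glue_of_disjoint hY hd,
    Finset.sum_mul]
  calc _ = ∑ a : Config ι Y, ∑ c : Config ι Z, ∑ b : Config ι Y, ∑ d : Config ι Z,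
        M (glue c (glue a σ)) (glue d (glue b τ)) *
          Ψ (Matrix.single c d 1) (restrict hZ σ) (restrict hZ τ) *
          Φ (Matrix.single a b 1) (restrict hY σ) (restrict hY τ) :=
        Finset.sum_congr rfl fun a _ => Finset.sum_comm
    _ = ∑ c : Config ι Z, ∑ a : Config ι Y, ∑ d : Config ι Z, ∑ b : Config ι Y,
        M (glue c (glue a σ)) (glue d (glue b τ)) *
          Ψ (Matrix.single c d 1) (restrict hZ σ) (restrict hZ τ) *
          Φ (Matrix.single a b 1) (restrict hY σ) (restrict hY τ) := by
        rw [Finset.sum_comm]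
        exact Finset.sum_congr rfl fun c _ => Finset.sum_congr rfl fun a _ => Finset.sum_comm
    _ = _ := by
        refine Finset.sum_congr rfl fun c _ => ?_
        rw [Finset.sum_comm]
        refine Finset.sum_congr rfl fun d _ => Finset.sum_congr rfl fun a _ =>
          Finset.sum_congr rfl fun b _ => ?_
        rw [glue_comm hd c a σ, glue_comm hd d b τ]
        ring

theorem IsLindblad.eq_zero_of_subsingleton {I : Type*} [Fintype I] [DecidableEq I]
    [Subsingleton I] {Φ : Matrix I I ℂ →ₗ[ℂ] Matrix I I ℂ} (h : IsLindblad Φ) : Φ = 0 := by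
  refine LinearMap.ext fun A => ?_
  rcases isEmpty_or_nonempty I with hI | ⟨⟨i⟩⟩
  · ext i
    exact hI.elim i
  · have : A = A i i • (1 : Matrix I I ℂ) := by
      ext a b
      rw [Subsingleton.elim a i, Subsingleton.elim b i]
      simp
    rw [this, map_smul, h.map_one, smul_zero]
    rfl

theorem cbNorm_zero {I : Type*} [Fintype I] [DecidableEq I] :
    cbNorm (0 : Matrix I I ℂ →ₗ[ℂ] Matrix I I ℂ) = 0 := by
  have : ∀ n : ℕ, amplify n (0 : Matrix I I ℂ →ₗ[ℂ] Matrix I I ℂ) = 0 := fun n => rfl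
  simp [cbNorm, this]

theorem cbNorm_eq_zero_of_empty {Φ : Obs ι ∅ →ₗ[ℂ] Obs ι ∅} (h : IsLindblad Φ) :
    cbNorm Φ = 0 := by
  have : Subsingleton (Config ι (∅ : Finset Γ)) :=
    ⟨fun a b => funext fun x => absurd x.2 (Finset.notMem_empty _)⟩
  rw [h.eq_zero_of_subsingleton, cbNorm_zero]

end Extend

/-! ### The hopping operator of a weighted family of sets -/

section Hopping

variable {Γ : Type*} [DecidableEq Γ]

/-- The operator on functions on `Γ` with matrix entries `∑_{W ∋ y, z} c W`, the sum being over
the sets `W` of the family `𝒵`. -/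
def hop (𝒵 : Finset (Finset Γ)) (c : Finset Γ → ℝ) : (Γ → ℝ) →ₗ[ℝ] (Γ → ℝ) where
  toFun g y := ∑ W ∈ 𝒵 with y ∈ W, c W * ∑ z ∈ W, g z
  map_add' g g' := by
    funext y
    simp [Finset.sum_add_distrib, mul_add]
  map_smul' a g := by
    funext y
    simp only [Pi.smul_apply, smul_eq_mul, ← Finset.mul_sum, RingHom.id_apply]
    rw [Finset.mul_sum]
    exact Finset.sum_congr rfl fun W _ => by ring

variable (𝒵 : Finset (Finset Γ)) (c : Finset Γ → ℝ)

theorem hop_apply (g : Γ → ℝ) (y : Γ) :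
    hop 𝒵 c g y = ∑ W ∈ 𝒵 with y ∈ W, c W * ∑ z ∈ W, g z := rfl

/-- The indicator function of a finite set. -/
def ind (X : Finset Γ) : Γ → ℝ := fun y => if y ∈ X then 1 else 0

theorem ind_nonneg (X : Finset Γ) (y : Γ) : 0 ≤ ind X y := by
  unfold ind
  split_ifs <;> norm_num

variable {𝒵 c}

theorem hop_nonneg (hc : ∀ W, 0 ≤ c W) {g : Γ → ℝ} (hg : ∀ y, 0 ≤ g y) (y : Γ) :
    0 ≤ hop 𝒵 c g y :=
  Finset.sum_nonneg fun W _ => mul_nonneg (hc W) (Finset.sum_nonneg fun z _ => hg z)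

theorem hop_pow_nonneg (hc : ∀ W, 0 ≤ c W) {g : Γ → ℝ} (hg : ∀ y, 0 ≤ g y) (n : ℕ) (y : Γ) :
    0 ≤ (hop 𝒵 c ^ n) g y := by
  induction n generalizing y with
  | zero => exact hg y
  | succ n ih =>
    rw [pow_succ']
    exact hop_nonneg hc ih y

theorem hop_pow_one_le (hc : ∀ W, 0 ≤ c W) (n : ℕ) (y : Γ) :
    (hop 𝒵 c ^ n) (fun _ => 1) y ≤ (∑ W ∈ 𝒵, c W * W.card) ^ n := by
  induction n generalizing y with
  | zero => simp
  | succ n ih =>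
    rw [pow_succ', pow_succ', Module.End.mul_apply, hop_apply, Finset.sum_mul]
    refine (Finset.sum_le_sum (g := fun W : Finset Γ => c W * W.card *
      (∑ W ∈ 𝒵, c W * W.card) ^ n) fun W _ => ?_).trans ?_
    · rw [mul_assoc]
      refine mul_le_mul_of_nonneg_left ?_ (hc W)
      refine (Finset.sum_le_card_nsmul _ _ _ fun z _ => ih z).trans ?_
      rw [nsmul_eq_mul]
    · refine Finset.sum_le_sum_of_subset_of_nonneg (Finset.filter_subset _ _) fun W _ _ => ?_
      have : 0 ≤ ∑ W ∈ 𝒵, c W * (W.card : ℝ) :=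
        Finset.sum_nonneg fun W _ => mul_nonneg (hc W) (Nat.cast_nonneg _)
      exact mul_nonneg (mul_nonneg (hc W) (Nat.cast_nonneg _)) (pow_nonneg this n)

theorem hop_eq_sum {Λ : Finset Γ} (h𝒵 : ∀ W ∈ 𝒵, W ⊆ Λ) (g : Γ → ℝ) (y : Γ) :
    hop 𝒵 c g y = ∑ z ∈ Λ, (∑ W ∈ 𝒵 with y ∈ W ∧ z ∈ W, c W) * g z := by
  have h1 : ∀ W ∈ 𝒵.filter (y ∈ ·), c W * ∑ z ∈ W, g z =
      ∑ z ∈ Λ, if z ∈ W then c W * g z else 0 := by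
    intro W hW
    rw [Finset.mul_sum, ← Finset.sum_filter, Finset.filter_mem_eq_inter,
      Finset.inter_eq_right.2 (h𝒵 W (Finset.mem_filter.1 hW).1)]
  rw [hop_apply, Finset.sum_congr rfl h1, Finset.sum_comm]
  refine Finset.sum_congr rfl fun z _ => ?_
  rw [← Finset.sum_filter, Finset.filter_filter, Finset.sum_mul]

/-- Partial sums of the exponential series of the hopping operator applied to the indicator of
`X`, with a remainder. -/
noncomputable def hopSum (𝒵 : Finset (Finset Γ)) (c : Finset Γ → ℝ) (X : Finset Γ) (N : ℕ) (t : ℝ) : Γ → ℝ :=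
  ∑ n ∈ Finset.range N, (t ^ n / n !) • (hop 𝒵 c ^ n) (ind X) +
    (t ^ N / N !) • (hop 𝒵 c ^ N) (fun _ => 1)

theorem hopSum_apply (X : Finset Γ) (N : ℕ) (t : ℝ) (y : Γ) : hopSum 𝒵 c X N t y =
    ∑ n ∈ Finset.range N, t ^ n / n ! * (hop 𝒵 c ^ n) (ind X) y +
      t ^ N / N ! * (hop 𝒵 c ^ N) (fun _ => 1) y := by
  simp [hopSum, Finset.sum_apply]

theorem hopSum_nonneg (hc : ∀ W, 0 ≤ c W) (X : Finset Γ) (N : ℕ) {t : ℝ} (ht : 0 ≤ t) (y : Γ) :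
    0 ≤ hopSum 𝒵 c X N t y := by
  rw [hopSum_apply]
  refine add_nonneg (Finset.sum_nonneg fun n _ => ?_) ?_
  · exact mul_nonneg (by positivity) (hop_pow_nonneg hc (ind_nonneg X) n y)
  · exact mul_nonneg (by positivity) (hop_pow_nonneg hc (fun _ => zero_le_one) N y)

theorem hasDerivAt_pow_div_factorial (n : ℕ) (t : ℝ) :
    HasDerivAt (fun s : ℝ => s ^ (n + 1) / ((n + 1)! : ℝ)) (t ^ n / (n ! : ℝ)) t := by
  refine ((hasDerivAt_pow (n + 1) t).div_const _).congr_deriv ?_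
  rw [Nat.factorial_succ]
  have : (n ! : ℝ) ≠ 0 := Nat.cast_ne_zero.2 n.factorial_ne_zero
  push_cast
  field_simp

theorem hasDerivAt_hopSum (X : Finset Γ) (N : ℕ) (t : ℝ) (y : Γ) :
    HasDerivAt (fun s => hopSum 𝒵 c X (N + 1) s y) (hop 𝒵 c (hopSum 𝒵 c X N t) y) t := by
  have e : ∀ s, hopSum 𝒵 c X (N + 1) s y =
      (∑ n ∈ Finset.range N, s ^ (n + 1) / (n + 1)! * (hop 𝒵 c ^ (n + 1)) (ind X) y + ind X y) +
      s ^ (N + 1) / (N + 1)! * (hop 𝒵 c ^ (N + 1)) (fun _ => 1) y := by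
    intro s
    rw [hopSum_apply, Finset.sum_range_succ']
    simp
  have e' : hop 𝒵 c (hopSum 𝒵 c X N t) y =
      (∑ n ∈ Finset.range N, t ^ n / n ! * (hop 𝒵 c ^ (n + 1)) (ind X) y) +
      t ^ N / N ! * (hop 𝒵 c ^ (N + 1)) (fun _ => 1) y := by
    simp [hopSum, map_add, map_sum, map_smul, Finset.sum_apply, pow_succ', Module.End.mul_apply]
  rw [e']
  simp only [e]
  refine HasDerivAt.add ?_ ((hasDerivAt_pow_div_factorial N t).mul_const _)
  refine HasDerivAt.add_const _ ?_
  exact HasDerivAt.fun_sum fun n _ => (hasDerivAt_pow_div_factorial n t).mul_const _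

theorem hopSum_succ_zero (X : Finset Γ) (N : ℕ) (y : Γ) :
    hopSum 𝒵 c X (N + 1) 0 y = ind X y := by
  rw [hopSum_apply, Finset.sum_range_succ']
  simp

end Hopping

/-! ### Propagation bound -/

section Propagation

open Filter Topology

variable {Γ : Type*} [DecidableEq Γ] {E : Type*} [NormedAddCommGroup E] [NormedSpace ℂ E]
  [CompleteSpace E]

/-- A family of dissipative bounded operators labelled by finite sets, commuting for disjoint
labels. -/
structure IsLocalFamily (D : Finset Γ → E →L[ℂ] E) (c : Finset Γ → ℝ) : Prop where
  nonneg : ∀ Z, 0 ≤ c Z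
  bound : ∀ Z A, ‖D Z A‖ ≤ c Z * ‖A‖
  empty : c ∅ = 0
  dissipative : ∀ Z, IsDissipative (D Z)
  comm : ∀ Y Z, Disjoint Y Z → ∀ A, D Y (D Z A) = D Z (D Y A)

theorem IsDissipative.norm_exp_apply_le {D : E →L[ℂ] E} (h : IsDissipative D) {t : ℝ} (ht : 0 ≤ t)
    (A : E) : ‖NormedSpace.exp ((t : ℂ) • D) A‖ ≤ ‖A‖ :=
  (ContinuousLinearMap.le_opNorm _ _).trans
    (mul_le_of_le_one_left (norm_nonneg _) (h.norm_exp_le ht))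

theorem exp_zero_smul_apply (D : E →L[ℂ] E) (A : E) :
    NormedSpace.exp (((0 : ℝ) : ℂ) • D) A = A := by
  rw [Complex.ofReal_zero, zero_smul, NormedSpace.exp_zero]
  rfl

theorem hasDerivAt_exp_apply (D : E →L[ℂ] E) (A : E) (t : ℝ) :
    HasDerivAt (fun u : ℝ => NormedSpace.exp ((u : ℂ) • D) A)
      (D (NormedSpace.exp ((t : ℂ) • D) A)) t := by
  have := ((ContinuousLinearMap.apply ℂ E A).restrictScalars ℝ).hasFDerivAt.comp_hasDerivAt t
    (hasDerivAt_exp_ofReal_smul D t)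
  exact this

theorem IsLocalFamily.norm_apply_exp_le_hopSum {D : Finset Γ → E →L[ℂ] E} {c : Finset Γ → ℝ}
    (h : IsLocalFamily D c) (𝒵 : Finset (Finset Γ)) {X : Finset Γ} {A : E}
    (hA : ∀ Z, Disjoint X Z → D Z A = 0) (N : ℕ) {t : ℝ} (ht : 0 ≤ t) (Z : Finset Γ) :
    ‖D Z (NormedSpace.exp ((t : ℂ) • ∑ W ∈ 𝒵, D W) A)‖ ≤
      c Z * ‖A‖ * ∑ y ∈ Z, hopSum 𝒵 c X N t y := by
  induction N generalizing t Z with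
  | zero =>
    rcases Z.eq_empty_or_nonempty with rfl | hZ
    · refine (h.bound _ _).trans ?_
      simp [h.empty]
    · have h1 : (1 : ℝ) ≤ ∑ y ∈ Z, hopSum 𝒵 c X 0 t y := by
        simp only [hopSum_apply]
        simpa using hZ
      have h2 := (IsDissipative.sum fun W (_ : W ∈ 𝒵) => h.dissipative W).norm_exp_apply_le ht A
      calc _ ≤ c Z * ‖NormedSpace.exp ((t : ℂ) • ∑ W ∈ 𝒵, D W) A‖ := h.bound _ _
        _ ≤ c Z * ‖A‖ := mul_le_mul_of_nonneg_left h2 (h.nonneg Z)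
        _ ≤ _ := le_mul_of_one_le_right (mul_nonneg (h.nonneg Z) (norm_nonneg A)) h1
  | succ N ih =>
    set T : ℝ → E := fun s => NormedSpace.exp ((s : ℂ) • ∑ W ∈ 𝒵, D W) A with hT
    have hd : ∀ s, HasDerivAt (fun s => D Z (T s))
        ((∑ W ∈ 𝒵 with Disjoint W Z, D W) (D Z (T s)) +
          D Z (∑ W ∈ 𝒵 with ¬ Disjoint W Z, D W (T s))) s := by
      intro s
      have h1 := ((D Z).restrictScalars ℝ).hasFDerivAt.comp_hasDerivAt s
        (hasDerivAt_exp_apply (∑ W ∈ 𝒵, D W) A s)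
      refine HasDerivAt.congr_deriv h1 ?_
      change D Z ((∑ W ∈ 𝒵, D W) (T s)) = _
      rw [← Finset.sum_filter_add_sum_filter_not 𝒵 (fun W => Disjoint W Z),
        add_apply, map_add, sum_apply,
        sum_apply, sum_apply, map_sum]
      congr 1
      refine Finset.sum_congr rfl fun W hW => ?_
      exact h.comm Z W (Finset.mem_filter.1 hW).2.symm _
    have hB : ∀ s, HasDerivAt (fun s => c Z * ‖A‖ * ∑ y ∈ Z, hopSum 𝒵 c X (N + 1) s y)
        (c Z * ‖A‖ * ∑ y ∈ Z, hop 𝒵 c (hopSum 𝒵 c X N s) y) s := fun s =>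
      (HasDerivAt.fun_sum fun y _ => hasDerivAt_hopSum X N s y).const_mul _
    refine IsDissipative.norm_le_of_hasDerivAt
      (IsDissipative.sum fun W (_ : W ∈ 𝒵.filter (Disjoint · Z)) => h.dissipative W)
      hd hB ?_ ht ?_
    · have hT0 : T 0 = A := by simp [hT]
      simp only [hT0, hopSum_succ_zero]
      by_cases hXZ : Disjoint X Z
      · rw [hA Z hXZ, norm_zero]
        exact mul_nonneg (mul_nonneg (h.nonneg Z) (norm_nonneg A))
          (Finset.sum_nonneg fun y _ => ind_nonneg X y)
      · obtain ⟨x, hx, hz⟩ := Finset.not_disjoint_iff.1 hXZ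
        refine (h.bound _ _).trans ?_
        refine le_mul_of_one_le_right (mul_nonneg (h.nonneg Z) (norm_nonneg A)) ?_
        have : ind X x = 1 := by simp [ind, hx]
        rw [← this]
        exact Finset.single_le_sum (fun y _ => ind_nonneg X y) hz
    · intro s hs _
      have hP : ∀ W : Finset Γ, 0 ≤ c W * ∑ z ∈ W, hopSum 𝒵 c X N s z := fun W =>
        mul_nonneg (h.nonneg W) (Finset.sum_nonneg fun z _ => hopSum_nonneg h.nonneg X N hs z)
      have h1 : ∑ W ∈ 𝒵 with ¬ Disjoint W Z, c W * ∑ z ∈ W, hopSum 𝒵 c X N s z ≤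
          ∑ y ∈ Z, hop 𝒵 c (hopSum 𝒵 c X N s) y := by
        simp only [hop_apply, Finset.sum_filter (p := fun W => _ ∈ W)]
        rw [Finset.sum_comm, Finset.sum_filter]
        refine Finset.sum_le_sum fun W _ => ?_
        by_cases hW : ¬ Disjoint W Z
        · rw [if_pos hW]
          obtain ⟨y, hy, hz⟩ := Finset.not_disjoint_iff.1 hW
          refine le_trans (le_of_eq ?_) (Finset.single_le_sum (f := fun y => if y ∈ W then
            c W * ∑ z ∈ W, hopSum 𝒵 c X N s z else 0) (fun y _ => ?_) hz)
          · simp [hy]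
          · split_ifs
            exacts [hP W, le_rfl]
        · rw [if_neg hW]
          refine Finset.sum_nonneg fun y _ => ?_
          split_ifs
          exacts [hP W, le_rfl]
      calc _ ≤ c Z * ‖∑ W ∈ 𝒵 with ¬ Disjoint W Z, D W (T s)‖ := h.bound _ _
        _ ≤ c Z * ∑ W ∈ 𝒵 with ¬ Disjoint W Z, ‖A‖ * (c W * ∑ z ∈ W, hopSum 𝒵 c X N s z) := by
          refine mul_le_mul_of_nonneg_left ?_ (h.nonneg Z)
          refine norm_sum_le_of_le _ fun W _ => (ih hs W).trans (le_of_eq (by ring))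
        _ ≤ _ := by
          rw [← Finset.mul_sum, ← mul_assoc]
          exact mul_le_mul_of_nonneg_left h1 (mul_nonneg (h.nonneg Z) (norm_nonneg A))

theorem IsLocalFamily.norm_apply_exp_le {D : Finset Γ → E →L[ℂ] E} {c : Finset Γ → ℝ}
    (h : IsLocalFamily D c) (𝒵 : Finset (Finset Γ)) {X : Finset Γ} {A : E}
    (hA : ∀ Z, Disjoint X Z → D Z A = 0) {t : ℝ} (ht : 0 ≤ t) (Z : Finset Γ) {Q : Γ → ℝ}
    (hQ : ∀ y ∈ Z, ∀ N : ℕ, ∑ n ∈ Finset.range N, t ^ n / n ! * (hop 𝒵 c ^ n) (ind X) y ≤ Q y) :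
    ‖D Z (NormedSpace.exp ((t : ℂ) • ∑ W ∈ 𝒵, D W) A)‖ ≤ c Z * ‖A‖ * ∑ y ∈ Z, Q y := by
  set κ : ℝ := ∑ W ∈ 𝒵, c W * W.card
  have lim : Tendsto (fun N : ℕ => c Z * ‖A‖ * ∑ y ∈ Z, (Q y + (t * κ) ^ N / N !)) atTop
      (𝓝 (c Z * ‖A‖ * ∑ y ∈ Z, (Q y + 0))) :=
    (tendsto_finsetSum _ fun y _ => tendsto_const_nhds.add
      (FloorSemiring.tendsto_pow_div_factorial_atTop (t * κ))).const_mul _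
  simp only [add_zero] at lim
  refine ge_of_tendsto' lim fun N => (h.norm_apply_exp_le_hopSum 𝒵 hA N ht Z).trans ?_
  refine mul_le_mul_of_nonneg_left (Finset.sum_le_sum fun y hy => ?_)
    (mul_nonneg (h.nonneg Z) (norm_nonneg A))
  rw [hopSum_apply]
  refine add_le_add (hQ y hy N) ?_
  rw [mul_pow, mul_div_right_comm]
  exact mul_le_mul_of_nonneg_left (hop_pow_one_le h.nonneg N y) (by positivity)

end Propagation

/-! ### Decay estimates -/

section Decay

variable {Γ : Type*} [MetricSpace Γ] {F : ℝ → ℝ}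

theorem IsFFunction.dist_pos (hF : IsFFunction Γ F) (x y : Γ) : 0 < F (dist x y) :=
  hF.pos _ dist_nonneg

theorem IsFFunction.inflation_finite (hF : IsFFunction Γ F) (X : Finset Γ) {r : ℝ} (hr : 0 ≤ r) :
    (inflation X r).Finite := by
  have h1 : inflation X r = ⋃ x ∈ X, {y | dist y x ≤ r} := by
    ext y
    simp [inflation]
  rw [h1]
  refine X.finite_toSet.biUnion fun x _ => ?_
  have h2 : ∑' y : Γ, ENNReal.ofReal (F (dist x y)) ≠ ∞ :=
    ((le_iSup (fun x : Γ => ∑' y : Γ, ENNReal.ofReal (F (dist x y))) x).trans_lt hF.summable).ne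
  refine (ENNReal.finite_const_le_of_tsum_ne_top h2
    (ENNReal.ofReal_pos.2 (hF.pos r hr)).ne').subset fun y hy => ?_
  refine ENNReal.ofReal_le_ofReal (hF.antitone dist_nonneg hr ?_)
  rw [dist_comm]
  exact hy

theorem IsFFunction.sum_le_tail (hF : IsFFunction Γ F) (ρ : ℝ) (x : Γ) (s : Finset Γ)
    (hs : ∀ y ∈ s, ρ < dist x y) : ∑ y ∈ s, F (dist x y) ≤ tail Γ F ρ := by
  have hle : ∀ x : Γ, ∑' y : {y : Γ // ρ < dist x y}, ENNReal.ofReal (F (dist x y)) ≤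
      ⨆ x : Γ, ∑' y : Γ, ENNReal.ofReal (F (dist x y)) := fun x =>
    (ENNReal.tsum_comp_le_tsum_of_injective Subtype.val_injective
      (fun y => ENNReal.ofReal (F (dist x y)))).trans
      (le_iSup (fun x : Γ => ∑' y : Γ, ENNReal.ofReal (F (dist x y))) x)
  have hfin : (⨆ x : Γ, ∑' y : {y : Γ // ρ < dist x y}, ENNReal.ofReal (F (dist x y))) ≠ ∞ :=
    ((iSup_le hle).trans_lt hF.summable).ne
  refine (ENNReal.ofReal_le_iff_le_toReal hfin).1 ?_
  refine le_trans ?_ (le_iSup _ x)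
  rw [ENNReal.ofReal_sum_of_nonneg fun y _ => (hF.dist_pos x y).le]
  rw [← Finset.sum_coe_sort]
  let f : s → {y : Γ // ρ < dist x y} := fun y => ⟨y, hs y y.2⟩
  have hf : Function.Injective f := fun a b hab => Subtype.ext (by simpa [f] using hab)
  rw [← tsum_fintype (L := .unconditional s)]
  exact ENNReal.tsum_comp_le_tsum_of_injective hf fun y => ENNReal.ofReal (F (dist x y))

theorem IsFFunction.sum_mul_le (hF : IsFFunction Γ F) (s : Finset Γ) (x y : Γ) :
    ∑ z ∈ s, F (dist x z) * F (dist z y) ≤ convConst Γ F * F (dist x y) := by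
  rw [← div_le_iff₀ (hF.dist_pos x y)]
  refine le_csInf hF.conv ?_
  rintro C ⟨hC, hconv⟩
  rw [div_le_iff₀ (hF.dist_pos x y)]
  refine (ENNReal.ofReal_le_ofReal_iff (mul_pos hC (hF.dist_pos x y)).le).1 ?_
  refine le_trans ?_ (hconv x y)
  rw [ENNReal.ofReal_sum_of_nonneg fun z _ => (mul_pos (hF.dist_pos x z) (hF.dist_pos z y)).le]
  exact ENNReal.sum_le_tsum s

theorem IsFFunction.convConst_pos [Nonempty Γ] (hF : IsFFunction Γ F) : 0 < convConst Γ F := by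
  obtain ⟨x⟩ := ‹Nonempty Γ›
  have h := hF.sum_mul_le {x} x x
  rw [Finset.sum_singleton] at h
  exact (hF.dist_pos x x).trans_le (le_of_mul_le_mul_right h (hF.dist_pos x x))

end Decay

section ExpTail

theorem expTail_eq (t k : ℝ) :
    expTail t k = Real.exp t - ∑ n ∈ Finset.range ⌈k⌉₊, t ^ n / (n ! : ℝ) := by
  have h := (Real.summable_pow_div_factorial t).sum_add_tsum_nat_add ⌈k⌉₊
  have h2 : ∑' n : ℕ, t ^ n / (n ! : ℝ) = Real.exp t := by
    rw [Real.exp_eq_exp_ℝ, NormedSpace.exp_eq_tsum_div]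
  rw [h2] at h
  rw [← h, expTail]
  simp only [add_comm ⌈k⌉₊]
  ring

theorem sum_ite_le_expTail {t : ℝ} (ht : 0 ≤ t) (k : ℝ) (N : ℕ) :
    ∑ n ∈ Finset.range N, (if ⌈k⌉₊ ≤ n then t ^ n / (n ! : ℝ) else 0) ≤ expTail t k := by
  rw [expTail_eq, le_sub_iff_add_le]
  refine le_trans ?_ (Real.sum_le_exp_of_nonneg ht (max N ⌈k⌉₊))
  rw [← Finset.sum_filter, ← Finset.sum_union]
  · refine Finset.sum_le_sum_of_subset_of_nonneg ?_ fun n _ _ => by positivity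
    intro n hn
    simp only [Finset.mem_union, Finset.mem_filter, Finset.mem_range] at hn ⊢
    rw [lt_max_iff]
    tauto
  · rw [Finset.disjoint_left]
    intro n hn
    simp only [Finset.mem_filter, Finset.mem_range] at hn ⊢
    exact not_lt.2 hn.2

theorem expTail_nonneg {t : ℝ} (ht : 0 ≤ t) (k : ℝ) : 0 ≤ expTail t k := by
  simpa using sum_ite_le_expTail ht k 0

theorem hasDerivAt_expTail {k : ℝ} (hk : 0 ≤ k) (t : ℝ) :
    HasDerivAt (fun s => expTail s (1 + k)) (expTail t k) t := by
  have hceil : ⌈1 + k⌉₊ = ⌈k⌉₊ + 1 := by rw [add_comm, Nat.ceil_add_one hk]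
  have e : ∀ s, expTail s (1 + k) =
      Real.exp s - (∑ n ∈ Finset.range ⌈k⌉₊, s ^ (n + 1) / ((n + 1)! : ℝ) + 1) := by
    intro s
    rw [expTail_eq, hceil, Finset.sum_range_succ']
    simp
  simp only [e]
  rw [expTail_eq]
  refine (Real.hasDerivAt_exp t).sub (HasDerivAt.add_const _ ?_)
  exact HasDerivAt.fun_sum fun n _ => hasDerivAt_pow_div_factorial n t

theorem expTail_zero {k : ℝ} (hk : 0 ≤ k) : expTail 0 (1 + k) = 0 := by
  have hceil : ⌈1 + k⌉₊ = ⌈k⌉₊ + 1 := by rw [add_comm, Nat.ceil_add_one hk]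
  rw [expTail_eq, hceil, Finset.sum_range_succ']
  simp

end ExpTail

section HopDecay

variable {Γ : Type*} [MetricSpace Γ] [DecidableEq Γ] {F : ℝ → ℝ} {𝒵 : Finset (Finset Γ)}
  {c : Finset Γ → ℝ} {Λ X : Finset Γ} {M R : ℝ}

theorem hop_entry_le (hdiam : ∀ W ∈ 𝒵, Metric.diam (W : Set Γ) ≤ R)
    (hc : ∀ y z, ∑ W ∈ 𝒵 with y ∈ W ∧ z ∈ W, c W ≤ M * F (dist y z)) (y z : Γ) :
    ∑ W ∈ 𝒵 with y ∈ W ∧ z ∈ W, c W ≤ if dist y z ≤ R then M * F (dist y z) else 0 := by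
  split_ifs with h
  · exact hc y z
  · refine le_of_eq (Finset.sum_eq_zero fun W hW => ?_)
    obtain ⟨h1, h2, h3⟩ := Finset.mem_filter.1 hW
    exact absurd ((Metric.dist_le_diam_of_mem W.finite_toSet.isBounded h2 h3).trans (hdiam W h1)) h

theorem hop_pow_ind_le (hF : IsFFunction Γ F) (hM : 0 ≤ M) (hC : 0 < convConst Γ F)
    (h𝒵 : ∀ W ∈ 𝒵, W ⊆ Λ) (hX : X ⊆ Λ)
    (hdiam : ∀ W ∈ 𝒵, Metric.diam (W : Set Γ) ≤ R) (hc0 : ∀ W, 0 ≤ c W)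
    (hc : ∀ y z, ∑ W ∈ 𝒵 with y ∈ W ∧ z ∈ W, c W ≤ M * F (dist y z)) (n : ℕ) (y : Γ) :
    (hop 𝒵 c ^ (n + 1)) (ind X) y * convConst Γ F ≤ (M * convConst Γ F) ^ (n + 1) *
      ∑ x ∈ X, if dist y x ≤ (n + 1 : ℕ) * R then F (dist y x) else 0 := by
  set C := convConst Γ F
  have hite : ∀ (p : Prop) [Decidable p] (x y : Γ), 0 ≤ if p then F (dist x y) else 0 := by
    intro p _ x y
    split_ifs
    exacts [(hF.dist_pos x y).le, le_rfl]
  induction n generalizing y with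
  | zero =>
    rw [zero_add, pow_one, hop_eq_sum h𝒵, mul_comm, pow_one, mul_comm M C, mul_assoc,
      Nat.cast_one, one_mul]
    refine mul_le_mul_of_nonneg_left ?_ hC.le
    simp only [ind, Finset.mul_sum, mul_ite, mul_one, mul_zero]
    rw [← Finset.sum_filter, Finset.filter_mem_eq_inter, Finset.inter_eq_right.2 hX]
    exact Finset.sum_le_sum fun x _ => hop_entry_le hdiam hc y x
  | succ n ih =>
    rw [pow_succ', Module.End.mul_apply, hop_eq_sum h𝒵, Finset.sum_mul]
    have h1 : ∀ z ∈ Λ, (∑ W ∈ 𝒵 with y ∈ W ∧ z ∈ W, c W) * (hop 𝒵 c ^ (n + 1)) (ind X) z * C ≤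
        ∑ x ∈ X, if dist y x ≤ (n + 1 + 1 : ℕ) * R then
          M * (M * C) ^ (n + 1) * (F (dist y z) * F (dist z x)) else 0 := by
      intro z _
      rw [mul_assoc]
      refine (mul_le_mul_of_nonneg_left (ih z) (Finset.sum_nonneg fun W _ => hc0 W)).trans ?_
      have hMC : 0 ≤ (M * C) ^ (n + 1) := pow_nonneg (mul_nonneg hM hC.le) _
      have hS : 0 ≤ ∑ x ∈ X, if dist z x ≤ (n + 1 : ℕ) * R then F (dist z x) else 0 :=
        Finset.sum_nonneg fun x _ => hite _ z x
      refine (mul_le_mul_of_nonneg_right (hop_entry_le hdiam hc y z)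
        (mul_nonneg hMC hS)).trans ?_
      rw [Finset.mul_sum, Finset.mul_sum]
      refine Finset.sum_le_sum fun x _ => ?_
      have hpos : 0 ≤ M * (M * C) ^ (n + 1) * (F (dist y z) * F (dist z x)) :=
        mul_nonneg (mul_nonneg hM hMC) (mul_pos (hF.dist_pos y z) (hF.dist_pos z x)).le
      by_cases ha : dist y z ≤ R
      · by_cases hb : dist z x ≤ (n + 1 : ℕ) * R
        · have hab : dist y x ≤ (n + 1 + 1 : ℕ) * R := by
            refine (dist_triangle y z x).trans ?_
            push_cast at hb ⊢
            linarith
          rw [if_pos ha, if_pos hb, if_pos hab]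
          exact le_of_eq (by ring)
        · rw [if_neg hb, mul_zero, mul_zero]
          split_ifs
          exacts [hpos, le_rfl]
      · rw [if_neg ha, zero_mul]
        split_ifs
        exacts [hpos, le_rfl]
    refine (Finset.sum_le_sum h1).trans ?_
    rw [Finset.sum_comm, Finset.mul_sum]
    refine Finset.sum_le_sum fun x _ => ?_
    by_cases hx : dist y x ≤ (n + 1 + 1 : ℕ) * R
    · simp only [if_pos hx]
      rw [← Finset.mul_sum, pow_succ _ (n + 1)]
      have := hF.sum_mul_le Λ y x
      have h2 : 0 ≤ M * (M * C) ^ (n + 1) := mul_nonneg hM (pow_nonneg (mul_nonneg hM hC.le) _)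
      refine (mul_le_mul_of_nonneg_left this h2).trans (le_of_eq ?_)
      ring
    · simp only [if_neg hx, Finset.sum_const_zero, mul_zero, le_refl]

theorem sum_hop_pow_ind_le (hF : IsFFunction Γ F) (hM : 0 ≤ M) (hC : 0 < convConst Γ F)
    (h𝒵 : ∀ W ∈ 𝒵, W ⊆ Λ) (hX : X ⊆ Λ)
    (hdiam : ∀ W ∈ 𝒵, Metric.diam (W : Set Γ) ≤ R) (hc0 : ∀ W, 0 ≤ c W)
    (hc : ∀ y z, ∑ W ∈ 𝒵 with y ∈ W ∧ z ∈ W, c W ≤ M * F (dist y z)) {r : ℝ} (hr : 0 ≤ r)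
    (hR : 0 < R) {y : Γ} (hy : y ∉ inflation X r) {t : ℝ} (ht : 0 ≤ t) (N : ℕ) :
    ∑ n ∈ Finset.range N, t ^ n / n ! * (hop 𝒵 c ^ n) (ind X) y ≤
      expTail (M * convConst Γ F * t) (r / R) / convConst Γ F * ∑ x ∈ X, F (dist x y) := by
  set C := convConst Γ F
  have hyx : ∀ x ∈ X, r < dist y x := fun x hx => not_le.1 fun h => hy ⟨x, hx, h⟩
  have hS : 0 ≤ ∑ x ∈ X, F (dist x y) := Finset.sum_nonneg fun x _ => (hF.dist_pos x y).le
  have key : ∀ n, (hop 𝒵 c ^ n) (ind X) y * C ≤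
      (if ⌈r / R⌉₊ ≤ n then (M * C) ^ n else 0) * ∑ x ∈ X, F (dist x y) := by
    intro n
    have hnn : 0 ≤ (if ⌈r / R⌉₊ ≤ n then (M * C) ^ n else 0) * ∑ x ∈ X, F (dist x y) := by
      refine mul_nonneg ?_ hS
      split_ifs
      exacts [pow_nonneg (mul_nonneg hM hC.le) n, le_rfl]
    rcases n with _ | n
    · have hyX : y ∉ X := fun h => by
        have := hyx y h
        rw [dist_self] at this
        linarith
      simpa [ind, hyX] using hnn
    · refine (hop_pow_ind_le hF hM hC h𝒵 hX hdiam hc0 hc n y).trans ?_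
      by_cases hn : ⌈r / R⌉₊ ≤ n + 1
      · rw [if_pos hn]
        refine mul_le_mul_of_nonneg_left (Finset.sum_le_sum fun x _ => ?_)
          (pow_nonneg (mul_nonneg hM hC.le) _)
        rw [dist_comm x y]
        split_ifs
        exacts [le_rfl, (hF.dist_pos y x).le]
      · rw [if_neg hn, zero_mul]
        refine le_of_eq (mul_eq_zero_of_right _ (Finset.sum_eq_zero fun x hx => if_neg fun h => hn ?_))
        refine Nat.ceil_le.2 ?_
        rw [div_le_iff₀ hR]
        exact ((hyx x hx).trans_le h).le
  rw [div_mul_eq_mul_div, le_div_iff₀ hC, Finset.sum_mul]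
  have hMt : 0 ≤ M * C * t := mul_nonneg (mul_nonneg hM hC.le) ht
  calc _ ≤ ∑ n ∈ Finset.range N, (if ⌈r / R⌉₊ ≤ n then (M * C * t) ^ n / (n ! : ℝ) else 0) *
        ∑ x ∈ X, F (dist x y) := by
        refine Finset.sum_le_sum fun n _ => ?_
        rw [mul_assoc]
        refine (mul_le_mul_of_nonneg_left (key n) (by positivity)).trans (le_of_eq ?_)
        split_ifs
        · rw [mul_pow (M * C) t]
          ring
        · simp
    _ ≤ _ := by
        rw [← Finset.sum_mul]
        exact mul_le_mul_of_nonneg_right (sum_ite_le_expTail hMt _ N) hS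

theorem sum_large_diam_le (hF : IsFFunction Γ F) (hM : 0 ≤ M) (h𝒵 : ∀ W ∈ 𝒵, W ⊆ Λ)
    (hdiam : ∀ W ∈ 𝒵, R < Metric.diam (W : Set Γ)) (hR : 0 ≤ R) (hc0 : ∀ W, 0 ≤ c W)
    (hc : ∀ y z, ∑ W ∈ 𝒵 with y ∈ W ∧ z ∈ W, c W ≤ M * F (dist y z)) (y : Γ) :
    ∑ W ∈ 𝒵 with y ∈ W, c W ≤ M * tail Γ F (R / 2) := by
  have h1 : ∀ W ∈ 𝒵.filter (y ∈ ·),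
      c W ≤ ∑ z ∈ Λ with R / 2 < dist y z, if z ∈ W then c W else 0 := by
    intro W hW
    obtain ⟨hW, hy⟩ := Finset.mem_filter.1 hW
    have : ∃ z ∈ W, R / 2 < dist y z := by
      by_contra! H
      refine absurd (hdiam W hW) (not_lt.2 (Metric.diam_le_of_forall_dist_le hR fun a ha b hb => ?_))
      have := dist_triangle_left a b y
      linarith [H a ha, H b hb]
    obtain ⟨z, hz, hd⟩ := this
    refine le_trans (le_of_eq ?_) (Finset.single_le_sum (f := fun z => if z ∈ W then c W else 0)
      (fun z _ => ?_) (Finset.mem_filter.2 ⟨h𝒵 W hW hz, hd⟩))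
    · simp [hz]
    · split_ifs
      exacts [hc0 W, le_rfl]
  refine (Finset.sum_le_sum h1).trans ?_
  rw [Finset.sum_comm]
  refine (Finset.sum_le_sum (g := fun z => M * F (dist y z)) fun z _ => ?_).trans ?_
  · rw [← Finset.sum_filter, Finset.filter_filter]
    exact hc y z
  · rw [← Finset.mul_sum]
    exact mul_le_mul_of_nonneg_left
      (hF.sum_le_tail _ y _ fun z hz => (Finset.mem_filter.1 hz).2) hM

end HopDecay

/-! ### The finite-range approximation -/

section FiniteRange

variable {Γ : Type*} [MetricSpace Γ] [DecidableEq Γ]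
  {ι : Γ → Type*} [∀ x, Fintype (ι x)] [∀ x, DecidableEq (ι x)]
  {F : ℝ → ℝ} {L : ∀ Z : Finset Γ, Obs ι Z →ₗ[ℂ] Obs ι Z}

theorem tsum_cbNorm_le_fNorm (hF : IsFFunction Γ F) (x y : Γ) :
    ∑' Z : {Z : Finset Γ // x ∈ Z ∧ y ∈ Z}, cbNorm (L Z) ≤
      fNorm F L * ENNReal.ofReal (F (dist x y)) := by
  have h0 : ENNReal.ofReal (F (dist x y)) ≠ 0 := (ENNReal.ofReal_pos.2 (hF.dist_pos x y)).ne'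
  rw [← ENNReal.div_le_iff h0 ENNReal.ofReal_ne_top]
  refine le_sInf fun M hM => ?_
  rw [ENNReal.div_le_iff h0 ENNReal.ofReal_ne_top]
  exact hM x y

theorem cbNorm_ne_top (hF : IsFFunction Γ F) (hL : ∀ Z, IsLindblad (L Z)) (hLF : fNorm F L < ∞)
    (Z : Finset Γ) : cbNorm (L Z) ≠ ∞ := by
  rcases Z.eq_empty_or_nonempty with rfl | ⟨x, hx⟩
  · rw [cbNorm_eq_zero_of_empty (hL ∅)]
    exact ENNReal.zero_ne_top
  · refine (lt_of_le_of_lt ?_ (ENNReal.mul_lt_top hLF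
      (ENNReal.ofReal_lt_top (r := F (dist x x))))).ne
    exact (ENNReal.le_tsum (f := fun Z : {Z : Finset Γ // x ∈ Z ∧ x ∈ Z} => cbNorm (L Z))
      ⟨Z, hx, hx⟩).trans (tsum_cbNorm_le_fNorm hF x x)

theorem sum_cbNorm_le (hF : IsFFunction Γ F) (hL : ∀ Z, IsLindblad (L Z)) (hLF : fNorm F L < ∞)
    (𝒵 : Finset (Finset Γ)) (x y : Γ) :
    ∑ Z ∈ 𝒵 with x ∈ Z ∧ y ∈ Z, (cbNorm (L Z)).toReal ≤ (fNorm F L).toReal * F (dist x y) := by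
  rw [← ENNReal.toReal_sum fun Z _ => cbNorm_ne_top hF hL hLF Z,
    ← ENNReal.toReal_ofReal (hF.dist_pos x y).le, ← ENNReal.toReal_mul]
  refine ENNReal.toReal_mono (ENNReal.mul_lt_top hLF ENNReal.ofReal_lt_top).ne ?_
  refine le_trans ?_ (tsum_cbNorm_le_fNorm hF x y)
  let f : (𝒵.filter fun Z => x ∈ Z ∧ y ∈ Z) → {Z : Finset Γ // x ∈ Z ∧ y ∈ Z} :=
    fun Z => ⟨Z, (Finset.mem_filter.1 Z.2).2⟩
  have hf : Function.Injective f := fun a b hab => Subtype.ext (by simpa [f] using hab)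
  rw [← Finset.sum_coe_sort, ← tsum_fintype (L := .unconditional _)]
  exact ENNReal.tsum_comp_le_tsum_of_injective hf fun Z => cbNorm (L Z)

/-- The subsets of `Λ` of diameter at most `R`. -/
noncomputable abbrev smallSets (Λ : Finset Γ) (R : ℝ) : Finset (Finset Γ) :=
  Λ.powerset.filter fun Z : Finset Γ => Metric.diam (Z : Set Γ) ≤ R

/-- The subsets of `Λ` of diameter greater than `R`. -/
noncomputable abbrev largeSets (Λ : Finset Γ) (R : ℝ) : Finset (Finset Γ) :=
  Λ.powerset.filter fun Z : Finset Γ => ¬ Metric.diam (Z : Set Γ) ≤ R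

/-- The map of `Z` acting on the observables of `Λ`, or `0` if `Z` is not contained in `Λ`. -/
noncomputable def localMap (L : ∀ Z : Finset Γ, Obs ι Z →ₗ[ℂ] Obs ι Z) (Λ Z : Finset Γ) :
    Obs ι Λ →L[ℂ] Obs ι Λ :=
  if h : Z ⊆ Λ then LinearMap.toContinuousLinearMap (extend h (L Z)) else 0

theorem localMap_of_subset {Λ Z : Finset Γ} (h : Z ⊆ Λ) :
    localMap L Λ Z = LinearMap.toContinuousLinearMap (extend h (L Z)) := dif_pos h

theorem localMap_of_not_subset {Λ Z : Finset Γ} (h : ¬ Z ⊆ Λ) : localMap L Λ Z = 0 := dif_neg h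

theorem generator_eq_sum (Λ : Finset Γ) :
    LinearMap.toContinuousLinearMap (generator L Λ) = ∑ Z ∈ Λ.powerset, localMap L Λ Z := by
  rw [generator, map_sum]
  refine Eq.trans ?_ (Finset.sum_coe_sort Λ.powerset (localMap L Λ))
  exact Finset.sum_congr rfl fun Z _ => (localMap_of_subset (Finset.mem_powerset.1 Z.2)).symm

theorem generatorRange_eq_sum (Λ : Finset Γ) (R : ℝ) :
    LinearMap.toContinuousLinearMap (generatorRange L Λ R) =
      ∑ Z ∈ smallSets Λ R, localMap L Λ Z := by
  rw [generatorRange, map_sum, Finset.sum_filter, Finset.sum_filter]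
  refine Eq.trans ?_ (Finset.sum_coe_sort Λ.powerset
    fun Z => if Metric.diam (Z : Set Γ) ≤ R then localMap L Λ Z else 0)
  refine Finset.sum_congr rfl fun Z _ => ?_
  rw [localMap_of_subset (Finset.mem_powerset.1 Z.2)]

theorem isLocalFamily_localMap (hL : ∀ Z, IsLindblad (L Z)) (hfin : ∀ Z, cbNorm (L Z) ≠ ∞)
    (Λ : Finset Γ) : IsLocalFamily (localMap L Λ) fun Z => (cbNorm (L Z)).toReal where
  nonneg Z := ENNReal.toReal_nonneg
  bound Z A := by
    by_cases h : Z ⊆ Λ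
    · rw [localMap_of_subset h]
      exact norm_extend_le h (hfin Z) A
    · rw [localMap_of_not_subset h]
      simpa using mul_nonneg ENNReal.toReal_nonneg (norm_nonneg A)
  empty := by rw [cbNorm_eq_zero_of_empty (hL ∅), ENNReal.toReal_zero]
  dissipative Z := by
    by_cases h : Z ⊆ Λ
    · rw [localMap_of_subset h]
      exact (hL Z).isDissipative_extend h
    · rw [localMap_of_not_subset h]
      exact IsDissipative.zero
  comm Y Z hd A := by
    by_cases hY : Y ⊆ Λ
    · by_cases hZ : Z ⊆ Λ
      · rw [localMap_of_subset hY, localMap_of_subset hZ]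
        exact extend_comm hY hZ hd (L Y) (L Z) A
      · simp [localMap_of_not_subset hZ]
    · simp [localMap_of_not_subset hY]

theorem localMap_embed_eq_zero (hL : ∀ Z, IsLindblad (L Z)) {X Λ Z : Finset Γ} (hX : X ⊆ Λ)
    (hd : Disjoint X Z) (A : Obs ι X) : localMap L Λ Z (embed hX A) = 0 := by
  by_cases h : Z ⊆ Λ
  · rw [localMap_of_subset h]
    exact extend_embed_eq_zero h hX hd (hL Z).map_one A
  · rw [localMap_of_not_subset h]
    rfl

theorem localMap_eq_zero (hF : IsFFunction Γ F) (hL : ∀ Z, IsLindblad (L Z))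
    (hLF : fNorm F L < ∞) (h0 : (fNorm F L).toReal = 0) (Λ Z : Finset Γ) :
    localMap L Λ Z = 0 := by
  have hD := isLocalFamily_localMap hL (cbNorm_ne_top hF hL hLF) Λ
  have hc : (cbNorm (L Z)).toReal = 0 := by
    rcases Z.eq_empty_or_nonempty with rfl | ⟨x, hx⟩
    · exact hD.empty
    · have := sum_cbNorm_le hF hL hLF {Z} x x
      rw [h0, zero_mul, Finset.filter_singleton, if_pos ⟨hx, hx⟩, Finset.sum_singleton] at this
      exact le_antisymm this ENNReal.toReal_nonneg
  refine ContinuousLinearMap.ext fun A => ?_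
  have := hD.bound Z A
  rw [hc, zero_mul] at this
  simpa using this

theorem fNorm_eq_zero_of_isEmpty [IsEmpty Γ] : fNorm F L = 0 :=
  le_antisymm (sInf_le fun x => isEmptyElim x) bot_le

/-- The interaction terms of large diameter act weakly on observables evolved by the dynamics of
finite range. -/
theorem norm_sum_localMap_exp_le (hF : IsFFunction Γ F) (hL : ∀ Z, IsLindblad (L Z))
    (hLF : fNorm F L < ∞) (hC : 0 < convConst Γ F) {X Λ : Finset Γ} (hX : X ⊆ Λ) (A : Obs ι X)
    {s r R : ℝ} (hs : 0 ≤ s) (hr : 0 ≤ r) (hR : 0 < R) :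
    ‖(∑ Z ∈ largeSets Λ R, localMap L Λ Z)
      (dynamicsRange L Λ R s (embed hX A))‖ ≤
      ‖A‖ * (fNorm F L).toReal * tail Γ F (R / 2) * ((inflation X r).ncard +
        expTail ((fNorm F L).toReal * convConst Γ F * s) (r / R) / convConst Γ F *
          ∑ x ∈ X, ∑ y ∈ Λ with y ∉ inflation X r, F (dist x y)) := by
  set M := (fNorm F L).toReal
  set C := convConst Γ F
  have hM : 0 ≤ M := ENNReal.toReal_nonneg
  have hD := isLocalFamily_localMap hL (cbNorm_ne_top hF hL hLF) Λ
  set c : Finset Γ → ℝ := fun Z => (cbNorm (L Z)).toReal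
  set 𝒮 := smallSets Λ R
  set 𝒯 := largeSets Λ R
  have h𝒮 : ∀ W ∈ 𝒮, W ⊆ Λ := fun W hW => Finset.mem_powerset.1 (Finset.mem_filter.1 hW).1
  have h𝒯 : ∀ W ∈ 𝒯, W ⊆ Λ := fun W hW => Finset.mem_powerset.1 (Finset.mem_filter.1 hW).1
  set ε := expTail (M * C * s) (r / R)
  have hε : 0 ≤ ε := expTail_nonneg (mul_nonneg (mul_nonneg hM hC.le) hs) _
  let q : Γ → ℝ := fun y => ε / C * ∑ x ∈ X, F (dist x y)
  have hq : ∀ y, 0 ≤ q y := fun y => mul_nonneg (div_nonneg hε hC.le)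
    (Finset.sum_nonneg fun x _ => (hF.dist_pos x y).le)
  let w : Γ → ℝ := fun y => if y ∈ inflation X r then 1 else q y
  have hw : ∀ y, 0 ≤ w y := by
    intro y
    simp only [w]
    split_ifs
    exacts [zero_le_one, hq y]
  set T := dynamicsRange L Λ R s (embed hX A) with hT
  have hTdef : T = NormedSpace.exp ((s : ℂ) • ∑ W ∈ 𝒮, localMap L Λ W) (embed hX A) := by
    rw [hT, dynamicsRange, semigroup, generatorRange_eq_sum]
  have hA := norm_embed_le hX A
  have hterm : ∀ Z ∈ 𝒯, ‖localMap L Λ Z T‖ ≤ ‖A‖ * (c Z * ∑ y ∈ Z, w y) := by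
    intro Z hZ
    by_cases hZX : ∃ y ∈ Z, y ∈ inflation X r
    · obtain ⟨y, hyZ, hy⟩ := hZX
      have h1 : 1 ≤ ∑ y ∈ Z, w y := by
        refine le_trans (le_of_eq ?_) (Finset.single_le_sum (fun y _ => hw y) hyZ)
        simp only [w, if_pos hy]
      have h2 : ‖T‖ ≤ ‖A‖ := by
        rw [hTdef]
        exact ((IsDissipative.sum fun W _ => hD.dissipative W).norm_exp_apply_le hs _).trans hA
      calc _ ≤ c Z * ‖T‖ := hD.bound Z T
        _ ≤ c Z * ‖A‖ := mul_le_mul_of_nonneg_left h2 (hD.nonneg Z)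
        _ ≤ c Z * ‖A‖ * ∑ y ∈ Z, w y :=
          le_mul_of_one_le_right (mul_nonneg (hD.nonneg Z) (norm_nonneg A)) h1
        _ = _ := by ring
    · push Not at hZX
      have h1 := hD.norm_apply_exp_le 𝒮 (fun Z hd => localMap_embed_eq_zero hL hX hd A) hs Z
        (Q := w) fun y hy N => by
          have := sum_hop_pow_ind_le (c := c) hF hM hC h𝒮 hX
            (fun W hW => (Finset.mem_filter.1 hW).2) hD.nonneg (sum_cbNorm_le hF hL hLF 𝒮) hr hR
            (hZX y hy) hs N
          simpa only [w, if_neg (hZX y hy)] using this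
      rw [hTdef]
      refine h1.trans ?_
      rw [mul_right_comm, mul_comm]
      exact mul_le_mul_of_nonneg_right hA
        (mul_nonneg (hD.nonneg Z) (Finset.sum_nonneg fun y _ => hw y))
  rw [sum_apply]
  refine (norm_sum_le_of_le _ hterm).trans ?_
  rw [← Finset.mul_sum, mul_assoc, mul_assoc]
  refine mul_le_mul_of_nonneg_left ?_ (norm_nonneg A)
  have hswap : ∑ Z ∈ 𝒯, c Z * ∑ y ∈ Z, w y = ∑ y ∈ Λ, (∑ Z ∈ 𝒯 with y ∈ Z, c Z) * w y := by
    have h1 : ∀ Z ∈ 𝒯, c Z * ∑ y ∈ Z, w y = ∑ y ∈ Λ, if y ∈ Z then c Z * w y else 0 := by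
      intro Z hZ
      rw [Finset.mul_sum, ← Finset.sum_filter, Finset.filter_mem_eq_inter,
        Finset.inter_eq_right.2 (h𝒯 Z hZ)]
    rw [Finset.sum_congr rfl h1, Finset.sum_comm]
    refine Finset.sum_congr rfl fun y _ => ?_
    rw [← Finset.sum_filter, Finset.sum_mul]
  have hlarge : ∀ y, ∑ Z ∈ 𝒯 with y ∈ Z, c Z ≤ M * tail Γ F (R / 2) :=
    sum_large_diam_le hF hM h𝒯 (fun W hW => not_le.1 (Finset.mem_filter.1 hW).2) hR.le hD.nonneg
      (sum_cbNorm_le hF hL hLF 𝒯)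
  rw [hswap]
  refine (Finset.sum_le_sum fun y _ => mul_le_mul_of_nonneg_right (hlarge y) (hw y)).trans ?_
  rw [← Finset.mul_sum, mul_assoc]
  have htail : 0 ≤ tail Γ F (R / 2) := ENNReal.toReal_nonneg
  refine mul_le_mul_of_nonneg_left (mul_le_mul_of_nonneg_left ?_ htail) hM
  simp only [w]
  rw [Finset.sum_ite, Finset.sum_const, nsmul_eq_mul, mul_one, Finset.sum_comm, Finset.mul_sum]
  refine add_le_add ?_ le_rfl
  rw [← Set.ncard_coe_finset]
  exact_mod_cast Set.ncard_le_ncard (fun y hy => (Finset.mem_filter.1 hy).2)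
    (hF.inflation_finite X hr)

theorem norm_dynamics_sub_dynamicsRange_le (hF : IsFFunction Γ F) (hL : ∀ Z, IsLindblad (L Z))
    (hLF : fNorm F L < ∞) {X Λ : Finset Γ} (hX : X ⊆ Λ) (A : Obs ι X)
    {t r R : ℝ} (ht : 0 ≤ t) (hr : 0 ≤ r) (hR : 0 < R) :
    ‖dynamics L Λ t (embed hX A) - dynamicsRange L Λ R t (embed hX A)‖ ≤
      ‖A‖ * (fNorm F L).toReal * tail Γ F (R / 2) * (t * (inflation X r).ncard +
        expTail ((fNorm F L).toReal * convConst Γ F * t) (1 + r / R) /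
          ((fNorm F L).toReal * convConst Γ F * convConst Γ F) *
          ∑ x ∈ X, ∑ y ∈ Λ with y ∉ inflation X r, F (dist x y)) := by
  by_cases h0 : (fNorm F L).toReal = 0
  · rw [h0, mul_zero, zero_mul, zero_mul, dynamics, dynamicsRange, semigroup, semigroup,
      generator_eq_sum, generatorRange_eq_sum,
      Finset.sum_eq_zero fun Z _ => localMap_eq_zero hF hL hLF h0 Λ Z,
      Finset.sum_eq_zero fun Z _ => localMap_eq_zero hF hL hLF h0 Λ Z, sub_self, norm_zero]
  have : Nonempty Γ := by
    by_contra hne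
    rw [not_nonempty_iff] at hne
    exact h0 (by rw [fNorm_eq_zero_of_isEmpty, ENNReal.toReal_zero])
  have hC := hF.convConst_pos
  have hk : 0 ≤ r / R := div_nonneg hr hR.le
  set S := ∑ x ∈ X, ∑ y ∈ Λ with y ∉ inflation X r, F (dist x y) with hS
  set M := (fNorm F L).toReal with hM
  set C := convConst Γ F with hCdef
  have hD := isLocalFamily_localMap hL (cbNorm_ne_top hF hL hLF) Λ
  have hd : ∀ s : ℝ, HasDerivAt
      (fun s => dynamics L Λ s (embed hX A) - dynamicsRange L Λ R s (embed hX A))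
      ((∑ Z ∈ Λ.powerset, localMap L Λ Z)
        (dynamics L Λ s (embed hX A) - dynamicsRange L Λ R s (embed hX A)) +
      (∑ Z ∈ largeSets Λ R, localMap L Λ Z)
        (dynamicsRange L Λ R s (embed hX A))) s := by
    intro s
    refine ((hasDerivAt_exp_apply (LinearMap.toContinuousLinearMap (generator L Λ))
      (embed hX A) s).sub (hasDerivAt_exp_apply
      (LinearMap.toContinuousLinearMap (generatorRange L Λ R)) (embed hX A) s)).congr_deriv ?_
    change LinearMap.toContinuousLinearMap (generator L Λ) (dynamics L Λ s (embed hX A)) -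
      LinearMap.toContinuousLinearMap (generatorRange L Λ R)
        (dynamicsRange L Λ R s (embed hX A)) = _
    rw [generator_eq_sum, generatorRange_eq_sum, map_sub,
      ← Finset.sum_filter_add_sum_filter_not Λ.powerset
        (fun Z : Finset Γ => Metric.diam (Z : Set Γ) ≤ R) (localMap L Λ)]
    simp only [add_apply]
    abel
  have hB : ∀ s : ℝ, HasDerivAt (fun s : ℝ => ‖A‖ * M * tail Γ F (R / 2) *
      (s * (inflation X r).ncard + expTail (M * C * s) (1 + r / R) / (M * C * C) * S))
      (‖A‖ * M * tail Γ F (R / 2) *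
        ((inflation X r).ncard + expTail (M * C * s) (r / R) / C * S)) s := by
    intro s
    have h1 : HasDerivAt (fun s : ℝ => expTail (M * C * s) (1 + r / R))
        (expTail (M * C * s) (r / R) * (M * C)) s :=
      HasDerivAt.comp s (hasDerivAt_expTail hk (M * C * s)) (hasDerivAt_const_mul (M * C))
    have h2 := (((hasDerivAt_id s).mul_const ((inflation X r).ncard : ℝ)).add
      ((h1.div_const (M * C * C)).mul_const S)).const_mul (‖A‖ * M * tail Γ F (R / 2))
    refine h2.congr_deriv ?_
    have := hC.ne'
    field_simp
  refine IsDissipative.norm_le_of_hasDerivAt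
    (IsDissipative.sum fun Z (_ : Z ∈ Λ.powerset) => hD.dissipative Z) hd hB ?_ ht ?_
  · have h1 : dynamics L Λ 0 (embed hX A) = embed hX A := exp_zero_smul_apply _ _
    have h2 : dynamicsRange L Λ R 0 (embed hX A) = embed hX A := exp_zero_smul_apply _ _
    rw [h1, h2]
    simp [expTail_zero hk]
  · intro s hs _
    exact norm_sum_localMap_exp_le hF hL hLF hC hX A hs hr hR

end FiniteRange

end OpenSpin

theorem theorem2p4 {Γ : Type*} [MetricSpace Γ] [Countable Γ] [DecidableEq Γ]
    (ι : Γ → Type*) [∀ x, Fintype (ι x)] [∀ x, DecidableEq (ι x)]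
    (F : ℝ → ℝ) (hF : OpenSpin.IsFFunction Γ F)
    (L : ∀ Z : Finset Γ, OpenSpin.Obs ι Z →ₗ[ℂ] OpenSpin.Obs ι Z)
    (hL : ∀ Z, OpenSpin.IsLindblad (L Z)) (hLF : OpenSpin.fNorm F L < ∞)
    (X Λ : Finset Γ) (hX : X ⊆ Λ) (A : OpenSpin.Obs ι X)
    (t r R v C : ℝ) (ht : 0 ≤ t) (hr : 0 ≤ r) (hR : 0 < R)
    (hC : C = OpenSpin.convConst Γ F) (hv : v = (OpenSpin.fNorm F L).toReal * C) :
    (OpenSpin.inflation X r).Finite ∧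
    ‖OpenSpin.dynamics L Λ t (OpenSpin.embed hX A) -
        OpenSpin.dynamicsRange L Λ R t (OpenSpin.embed hX A)‖ ≤
      ‖A‖ * (OpenSpin.fNorm F L).toReal * OpenSpin.tail Γ F (R / 2) *
        (t * (OpenSpin.inflation X r).ncard +
          OpenSpin.expTail (v * t) (1 + r / R) / (v * C) *
            ∑ x ∈ X, ∑ y ∈ Λ with y ∉ OpenSpin.inflation X r, F (dist x y)) := by

  subst hC hv
  exact ⟨hF.inflation_finite X hr,
    OpenSpin.norm_dynamics_sub_dynamicsRange_le hF hL hLF hX A ht hr hR⟩
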